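/- All graphs are finite and simple, and $G$ denotes a graph. **Separators.** For $X\subseteq V(G)$ let $N(X)$ be the set of vertices outside $X$ with a neighbour in $X$. A *full component* of $S\subseteq V(G)$ is a connected component $A$ of $G-S$ with $N(A)=S$; $S$ is a *minimal separator* if it has at least two full components. A graph is *mesh* if its complement is not connected. A minimal separator $S$ is *subordinate* if there are a minimal separator $S'\supseteq S$ and two distinct full components $A',B'$ of $S'$ such that some full component of $S$ is disjoint from $A'\cup S'\cup B'$. A minimal separator that is not subordinate is *mesh*, *mixed* or *non-mesh* if exactly $2$, $1$ or $0$, respectively, of its full components induce mesh graphs. A set $\widetilde S\subseteq V(G)$ *carves away* a component $D$ of $G-S$ if no component of $G-\widetilde S$ intersects both $D$ and another component of $G-S$. **Treedepth structures.** In a rooted forest, the depth of a vertex is the number of vertices on its path to the root; each vertex is an ancestor of itself; two vertices are comparable if one is an ancestor of the other; a path is vertical if one of its ends is an ancestor of the other. For $d\ge 1$, a *treedepth-$d$ structure* in $G$ is a rooted forest $\mathcal T$ with $V(\mathcal T)\subseteq V(G)$ in which all depths are at most $d$ and such that any two vertices of $\mathcal T$ adjacent in $G$ are comparable. It is *maximal*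 if there is no treedepth-$d$ structure $\mathcal T'$ in $G$ such that $\mathcal T$ is a proper induced subgraph of $\mathcal T'$ and every root of $\mathcal T$ is a root of $\mathcal T'$. A minimal separator $S$ of $G$ is *$\mathcal T$-avoiding* if $S\cap V(\mathcal T)$ is contained in a vertical path of $\mathcal T$ and contains no vertex of depth $d$. For such $S$, a *$\mathcal T$-carver* for $S$ is a set $\widetilde S\subseteq V(G)$ with $\widetilde S\cap V(\mathcal T)=S\cap V(\mathcal T)$ such that 1. if $S$ is subordinate or non-mesh, then $\widetilde S=S$; 2. if $S$ is mixed, then $\widetilde S$ carves away the mesh full component of $S$; 3. if $S$ is mesh, then $\widetilde S$ carves away every component of $G-S$. **Proposition.** For every positive integer $d$ there is a polynomial-time algorithm that, given a graph $G$ with no induced path on six vertices, returns a collection $\mathcal S\subseteq 2^{V(G)}$ such that for every maximal treedepth-$d$ structure $\mathcal T$ in $G$ and every $\mathcal T$-avoiding minimal separator $S$ of $G$, the collection $\mathcal S$ contains a $\mathcal T$-carver for $S$. -/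

import Mathlib

namespace SepCarving

/-! ### Separators and components -/

section Graphs

variable {V : Type*} (G : SimpleGraph V)

/-- `G` has no induced path on six vertices. -/
def P6Free : Prop := ¬ (SimpleGraph.pathGraph 6).IsIndContained G

/-- The open neighbourhood `N(X)` of a set of vertices. -/
def nbhd (X : Set V) : Set V := {u | u ∉ X ∧ ∃ v ∈ X, G.Adj u v}

/-- `D` is the vertex set of a connected component of `G - S`. -/
def IsComp (S D : Set V) : Prop :=
  ∃ c : (G.induce Sᶜ).ConnectedComponent, D = Subtype.val '' c.supp

/-- `A` is a full component of `S`: a component of `G - S` with `N(A) = S`. -/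
def IsFullComp (S A : Set V) : Prop := IsComp G S A ∧ nbhd G A = S

/-- `S` is a minimal separator: it has at least two full components. -/
def IsMinSep (S : Set V) : Prop :=
  ∃ A B : Set V, A ≠ B ∧ IsFullComp G S A ∧ IsFullComp G S B

/-- The induced subgraph `G[A]` is mesh: its complement is not connected. -/
def IsMeshSet (A : Set V) : Prop := ¬ (G.induce A)ᶜ.Connected

/-- `S` is a subordinate minimal separator. -/
def IsSubordinate (S : Set V) : Prop :=
  IsMinSep G S ∧ ∃ S' A' B' C : Set V,
    IsMinSep G S' ∧ A' ≠ B' ∧ IsFullComp G S' A' ∧ IsFullComp G S' B' ∧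
    S ⊆ S' ∧ IsFullComp G S C ∧ Disjoint C (A' ∪ S' ∪ B')

/-- The full components of `S` that are mesh. -/
def meshFullComps (S : Set V) : Set (Set V) := {A | IsFullComp G S A ∧ IsMeshSet G A}

/-- Mesh minimal separators. -/
def IsMeshSep (S : Set V) : Prop :=
  IsMinSep G S ∧ ¬ IsSubordinate G S ∧ (meshFullComps G S).encard = 2

/-- Mixed minimal separators. -/
def IsMixedSep (S : Set V) : Prop :=
  IsMinSep G S ∧ ¬ IsSubordinate G S ∧ (meshFullComps G S).encard = 1

/-- Non-mesh minimal separators. -/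
def IsNonMeshSep (S : Set V) : Prop :=
  IsMinSep G S ∧ ¬ IsSubordinate G S ∧ (meshFullComps G S).encard = 0

/-- `S'` carves away the component `D` of `G - S`: no component of `G - S'` intersects both `D`
and another component of `G - S`. -/
def CarvesAway (S S' D : Set V) : Prop :=
  ∀ C, IsComp G S' C → (C ∩ D).Nonempty →
    ∀ D', IsComp G S D' → D' ≠ D → ¬ (C ∩ D').Nonempty

end Graphs

/-! ### Rooted forests and treedepth structures -/

/-- A rooted forest with vertices in `V`, given by its parent pointers; the roots are the vertices
without a parent. Well-foundedness says that following parents always ends, at a root. -/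
structure RootedForest (V : Type*) where
  /-- the vertices of the forest -/
  verts : Set V
  /-- the parent of a vertex, if any -/
  parent : V → Option V
  mem_of_parent : ∀ v u, parent v = some u → v ∈ verts ∧ u ∈ verts
  wf : WellFounded fun u v => parent v = some u

namespace RootedForest

variable {V : Type*} (T : RootedForest V)

/-- The roots. -/
def roots : Set V := {v | v ∈ T.verts ∧ T.parent v = none}

/-- Adjacency in the underlying undirected forest. -/
def Adj (u v : V) : Prop := T.parent u = some v ∨ T.parent v = some u

/-- `u` is an ancestor of `v`, i.e. lies on the path from `v` to its root (each vertex is an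
ancestor of itself). -/
def IsAncestor (u v : V) : Prop :=
  v ∈ T.verts ∧ Relation.ReflTransGen (fun x y => T.parent x = some y) v u

/-- The number of vertices on the path from `v` to its root; roots have depth `1`. -/
noncomputable def depth (v : V) : ℕ := {u | T.IsAncestor u v}.ncard

/-- `u` and `v` are joined by a vertical path. -/
def Comparable (u v : V) : Prop := T.IsAncestor u v ∨ T.IsAncestor v u

/-- `X` is contained in (the vertex set of) a vertical path, the one between some vertex `w` and
an ancestor `u` of `w`. (The empty set always qualifies.) -/
def InVerticalPath (X : Set V) : Prop :=
  X = ∅ ∨ ∃ u w, T.IsAncestor u w ∧ X ⊆ {x | T.IsAncestor u x ∧ T.IsAncestor x w}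

/-- `T` is a treedepth-`d` structure in `G`: its height is at most `d` and it is an elimination
forest of the subgraph of `G` induced by its vertices. -/
def IsTDStructure (G : SimpleGraph V) (d : ℕ) : Prop :=
  (∀ v ∈ T.verts, T.depth v ≤ d) ∧
    ∀ u ∈ T.verts, ∀ v ∈ T.verts, G.Adj u v → T.Comparable u v

/-- `T` is a proper induced subgraph of `T'`. -/
def IsProperInduced (T' : RootedForest V) : Prop :=
  T.verts ⊂ T'.verts ∧ ∀ u ∈ T.verts, ∀ v ∈ T.verts, T.Adj u v ↔ T'.Adj u v

/-- `T` is a maximal treedepth-`d` structure in `G`. -/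
def IsMaximalTDStructure (G : SimpleGraph V) (d : ℕ) : Prop :=
  T.IsTDStructure G d ∧
    ¬ ∃ T' : RootedForest V, T'.IsTDStructure G d ∧ T.IsProperInduced T' ∧ T.roots ⊆ T'.roots

/-- `S` is a `T`-avoiding minimal separator of `G` (for a treedepth-`d` structure `T`). -/
def IsAvoidingMinSep (G : SimpleGraph V) (d : ℕ) (S : Set V) : Prop :=
  IsMinSep G S ∧ T.InVerticalPath (S ∩ T.verts) ∧ ∀ v ∈ S ∩ T.verts, T.depth v ≠ d

/-- `S'` is a `T`-carver for the minimal separator `S` of `G`. -/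
def IsCarver (G : SimpleGraph V) (S S' : Set V) : Prop :=
  S' ∩ T.verts = S ∩ T.verts ∧
  (IsSubordinate G S ∨ IsNonMeshSep G S → S' = S) ∧
  (IsMixedSep G S → ∀ A, IsFullComp G S A → IsMeshSet G A → CarvesAway G S S' A) ∧
  (IsMeshSep G S → ∀ D, IsComp G S D → CarvesAway G S S' D)

end RootedForest

/-! ### Algorithms with a step count

A deterministic random access machine, programmed by structured programs. Memory consists of
natural-number variables and two-dimensional arrays of natural numbers. Elementary operations
(reading a variable or an array cell, addition, truncated subtraction, comparison, writing a cell,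
testing, producing output) cost one step each. There is no multiplication, so that numbers have at
most linearly many bits in the running time and polynomial time agrees with that of Turing
machines. -/

/-- Memory and output of the machine. -/
structure State where
  /-- the variables -/
  var : ℕ → ℕ
  /-- the arrays: `arr a i j` is the cell `(i, j)` of the array `a` -/
  arr : ℕ → ℕ → ℕ → ℕ
  /-- the output, a list of lists of numbers (latest first) -/
  out : List (List ℕ)

/-- Expressions. -/
inductive Expr where
  | const (c : ℕ)
  | var (x : ℕ)
  | read (a : ℕ) (i j : Expr)
  | add (e f : Expr)
  | sub (e f : Expr)
  | lt (e f : Expr)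
  | eq (e f : Expr)

/-- The value of an expression; comparisons give `1` or `0`. -/
def Expr.eval (s : State) : Expr → ℕ
  | .const c => c
  | .var x => s.var x
  | .read a i j => s.arr a (i.eval s) (j.eval s)
  | .add e f => e.eval s + f.eval s
  | .sub e f => e.eval s - f.eval s
  | .lt e f => if e.eval s < f.eval s then 1 else 0
  | .eq e f => if e.eval s = f.eval s then 1 else 0

/-- The number of steps needed to evaluate an expression. -/
def Expr.cost : Expr → ℕ
  | .const _ => 1
  | .var _ => 1
  | .read _ i j => i.cost + j.cost + 1
  | .add e f => e.cost + f.cost + 1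
  | .sub e f => e.cost + f.cost + 1
  | .lt e f => e.cost + f.cost + 1
  | .eq e f => e.cost + f.cost + 1

/-- Programs. -/
inductive Prog where
  /-- do nothing -/
  | skip
  /-- `x := e` -/
  | assign (x : ℕ) (e : Expr)
  /-- `a[i, j] := e` -/
  | store (a : ℕ) (i j e : Expr)
  /-- start a new, empty list in the output -/
  | newList
  /-- add the value of `e` to the most recent list in the output -/
  | put (e : Expr)
  | seq (c₁ c₂ : Prog)
  /-- if `e ≠ 0` then `c₁` else `c₂` -/
  | ite (e : Expr) (c₁ c₂ : Prog)
  /-- while `e ≠ 0` do `c` -/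
  | loop (e : Expr) (c : Prog)

/-- Add a number to the most recent list in the output (starting one if there is none). -/
def putOut (x : ℕ) : List (List ℕ) → List (List ℕ)
  | [] => [[x]]
  | l :: ls => (x :: l) :: ls

/-- `Exec c s t s'`: started in state `s`, the program `c` halts after exactly `t` steps, in
state `s'`. -/
inductive Exec : Prog → State → ℕ → State → Prop
  | skip (s : State) : Exec .skip s 1 s
  | assign (x : ℕ) (e : Expr) (s : State) :
      Exec (.assign x e) s (e.cost + 1) { s with var := Function.update s.var x (e.eval s) }
  | store (a : ℕ) (i j e : Expr) (s : State) :
      Exec (.store a i j e) s (i.cost + j.cost + e.cost + 1)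
        { s with arr := fun a' i' j' =>
            if a' = a ∧ i' = i.eval s ∧ j' = j.eval s then e.eval s else s.arr a' i' j' }
  | newList (s : State) : Exec .newList s 1 { s with out := [] :: s.out }
  | put (e : Expr) (s : State) :
      Exec (.put e) s (e.cost + 1) { s with out := putOut (e.eval s) s.out }
  | seq {c₁ c₂ : Prog} {s s₁ s₂ : State} {t₁ t₂ : ℕ} :
      Exec c₁ s t₁ s₁ → Exec c₂ s₁ t₂ s₂ → Exec (.seq c₁ c₂) s (t₁ + t₂) s₂
  | ite_true {e : Expr} {c₁ c₂ : Prog} {s s' : State} {t : ℕ} :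
      e.eval s ≠ 0 → Exec c₁ s t s' → Exec (.ite e c₁ c₂) s (e.cost + 1 + t) s'
  | ite_false {e : Expr} {c₁ c₂ : Prog} {s s' : State} {t : ℕ} :
      e.eval s = 0 → Exec c₂ s t s' → Exec (.ite e c₁ c₂) s (e.cost + 1 + t) s'
  | loop_false {e : Expr} {c : Prog} {s : State} :
      e.eval s = 0 → Exec (.loop e c) s (e.cost + 1) s
  | loop_true {e : Expr} {c : Prog} {s s₁ s₂ : State} {t₁ t₂ : ℕ} :
      e.eval s ≠ 0 → Exec c s t₁ s₁ → Exec (.loop e c) s₁ t₂ s₂ →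
        Exec (.loop e c) s (e.cost + 1 + t₁ + t₂) s₂

/-- The machine is deterministic: final state and number of steps are determined by the program
and the initial state. -/
theorem Exec.deterministic {c : Prog} {s s₁ : State} {t₁ : ℕ} (h₁ : Exec c s t₁ s₁) :
    ∀ {t₂ : ℕ} {s₂ : State}, Exec c s t₂ s₂ → t₁ = t₂ ∧ s₁ = s₂ := by
  induction h₁ with
  | skip | assign | store | newList | put => intro _ _ h; cases h; exact ⟨rfl, rfl⟩
  | seq _ _ ih₁ ih₂ =>
    intro _ _ h
    cases h with
    | seq k₁ k₂ =>
      obtain ⟨rfl, rfl⟩ := ih₁ k₁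
      obtain ⟨rfl, rfl⟩ := ih₂ k₂
      exact ⟨rfl, rfl⟩
  | ite_true he _ ih =>
    intro _ _ h
    cases h with
    | ite_true _ k => obtain ⟨rfl, rfl⟩ := ih k; exact ⟨rfl, rfl⟩
    | ite_false he' _ => exact absurd he' he
  | ite_false he _ ih =>
    intro _ _ h
    cases h with
    | ite_true he' _ => exact absurd he he'
    | ite_false _ k => obtain ⟨rfl, rfl⟩ := ih k; exact ⟨rfl, rfl⟩
  | loop_false he =>
    intro _ _ h
    cases h with
    | loop_false _ => exact ⟨rfl, rfl⟩
    | loop_true he' _ _ => exact absurd he he'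
  | loop_true he _ _ ih₁ ih₂ =>
    intro _ _ h
    cases h with
    | loop_false he' => exact absurd he' he
    | loop_true _ k₁ k₂ =>
      obtain ⟨rfl, rfl⟩ := ih₁ k₁
      obtain ⟨rfl, rfl⟩ := ih₂ k₂
      exact ⟨rfl, rfl⟩

open Classical in
/-- The initial state on input `G`: variable `0` holds the number of vertices, array `0` holds the
adjacency matrix, everything else is `0` and the output is empty. -/
noncomputable def inputState {n : ℕ} (G : SimpleGraph (Fin n)) : State where
  var x := if x = 0 then n else 0
  arr a i j := if a = 0 ∧ ∃ (hi : i < n) (hj : j < n), G.Adj ⟨i, hi⟩ ⟨j, hj⟩ then 1 else 0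
  out := []

/-- The output consists of lists of vertices, and `𝓢` is the collection of the sets listed. -/
def OutputsFamily {n : ℕ} (out : List (List ℕ)) (𝓢 : Set (Set (Fin n))) : Prop :=
  (∀ l ∈ out, ∀ x ∈ l, x < n) ∧ 𝓢 = {X | ∃ l ∈ out, X = {v : Fin n | (v : ℕ) ∈ l}}

/-- On input `G`, the program `c` halts after at most `t` steps and returns the collection `𝓢`. -/
def ReturnsWithin {n : ℕ} (c : Prog) (G : SimpleGraph (Fin n)) (t : ℕ)
    (𝓢 : Set (Set (Fin n))) : Prop :=
  ∃ t' ≤ t, ∃ s, Exec c (inputState G) t' s ∧ OutputsFamily s.out 𝓢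

end SepCarving

/-!
Trying all choices of boundedly many vertices takes polynomial time, so it is enough to recover a
carver for `S` from boundedly many vertices by a polynomial-time closure procedure. Let `A ≠ B` be
full components of `S`.

* Considering modules of `G[A]`, one finds two vertices of `A` such that each vertex of `S` that
  misses both starts an induced `P₄` whose other vertices lie in `A`, or has its neighbours in `A`
  complete to the rest of `A`. The second case is impossible if `A` is not mesh. In the first case,
  the vertex is complete to `B`, as `G` is `P₆`-free. It follows that six vertices of `A ∪ B`
  dominate `S`.
* If `S` is subordinate, witnessed by `S' ⊇ S`, then a full component of `S` is found by adding
  neighbours far from a bounded set that dominates `S'`.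
* If neither `A` nor `B` is mesh, then `A` is the only module of `G[A]` that contains some two
  vertices `p` and `q`. It is found from `{p, q}` by adding vertices that have both a neighbour and
  a non-neighbour in the current set and are far from two vertices of `B` chosen as above.
* If `A` is mesh, then `G[A]` has a co-component `K` that contains all but at most `d` vertices of
  `A ∩ V(T)`, since vertices of `T` in different co-components of `G[A]` are comparable. Starting in
  `K` and adding vertices that have a non-neighbour in the current set, see a vertex `y ∈ A \ K` and
  are far from suitable vertices of `B`, one obtains a set between `K` and `A ∪ S`. Together with
  `y` its neighbourhood carves away `A`, and inserting the few vertices of `T` in `A \ K` and in `S`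
  corrects the intersection with `V(T)`. If `B` is mesh as well, the set is also kept disjoint from
  `N(V(G) \ (A ∪ B ∪ S))`, which becomes a part of the carver. Here `P₆`-freeness ensures that the
  added vertices see nothing in a co-component of `G[B]` that contains almost all of `B ∩ V(T)`.
-/

namespace SepCarving

section Connectivity

variable {V : Type*} {G : SimpleGraph V} {A C D D' K S S' X : Set V}

theorem exists_adj_of_preconnected_induce (hA : (G.induce A).Preconnected) {a b : V} (ha : a ∈ A)
    (haX : a ∈ X) (hb : b ∈ A) (hbX : b ∉ X) :
    ∃ x ∈ A, x ∈ X ∧ ∃ y ∈ A, y ∉ X ∧ G.Adj x y := by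
  obtain ⟨w⟩ := hA ⟨a, ha⟩ ⟨b, hb⟩
  obtain ⟨e, -, hfst, hsnd⟩ := w.exists_boundary_dart {z | z.1 ∈ X} haX hbX
  exact ⟨e.fst.1, e.fst.2, hfst, e.snd.1, e.snd.2, hsnd, e.adj⟩

theorem subset_of_preconnected_induce (hA : (G.induce A).Preconnected) (hne : (A ∩ X).Nonempty)
    (hX : ∀ a ∈ A, a ∈ X → ∀ b ∈ A, G.Adj a b → b ∈ X) : A ⊆ X := by
  intro v hv
  by_contra hvX
  obtain ⟨x, hxA, hxX⟩ := hne
  obtain ⟨a, haA, haX, b, hbA, hbX, hab⟩ := exists_adj_of_preconnected_induce hA hxA hxX hv hvX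
  exact hbX (hX a haA haX b hbA hab)

theorem compl_induce (G : SimpleGraph V) (A : Set V) : (G.induce A)ᶜ = Gᶜ.induce A := by
  ext x y
  simp [SimpleGraph.compl_adj, Subtype.ext_iff]

theorem isMeshSet_iff (hA : A.Nonempty) :
    IsMeshSet G A ↔ ¬ (Gᶜ.induce A).Preconnected := by
  have := hA.to_subtype
  rw [IsMeshSet, compl_induce, SimpleGraph.connected_iff, and_iff_left this]

theorem IsComp.subset_compl (h : IsComp G S D) : D ⊆ Sᶜ := by
  obtain ⟨c, rfl⟩ := h
  rintro _ ⟨x, -, rfl⟩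
  exact x.2

theorem IsComp.nonempty (h : IsComp G S D) : D.Nonempty := by
  obtain ⟨c, rfl⟩ := h
  exact c.nonempty_supp.image _

theorem IsComp.mem_of_adj (h : IsComp G S D) {u v : V} (hu : u ∈ D) (huv : G.Adj u v)
    (hv : v ∉ S) : v ∈ D := by
  obtain ⟨c, rfl⟩ := h
  obtain ⟨x, hx, rfl⟩ := hu
  have hxv : (G.induce Sᶜ).Adj x ⟨v, hv⟩ := huv
  exact ⟨⟨v, hv⟩, (c.mem_supp_congr_adj hxv).1 hx, rfl⟩

theorem IsComp.preconnected (h : IsComp G S D) : (G.induce D).Preconnected := by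
  obtain ⟨c, rfl⟩ := h
  let f : c.toSimpleGraph →g G.induce (Subtype.val '' c.supp) :=
    ⟨fun x => ⟨x.1.1, x.1, x.2, rfl⟩, id⟩
  refine c.connected_toSimpleGraph.preconnected.map f ?_
  rintro ⟨_, x, hx, rfl⟩
  exact ⟨⟨x, hx⟩, rfl⟩

theorem IsComp.eq_of_mem (h : IsComp G S D) (h' : IsComp G S D') {v : V} (hv : v ∈ D)
    (hv' : v ∈ D') : D = D' :=
  (subset_of_preconnected_induce h.preconnected ⟨v, hv, hv'⟩ fun _ _ ha _ hb hab =>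
      h'.mem_of_adj ha hab (h.subset_compl hb)).antisymm
    (subset_of_preconnected_induce h'.preconnected ⟨v, hv', hv⟩ fun _ _ ha _ hb hab =>
      h.mem_of_adj ha hab (h'.subset_compl hb))

theorem exists_isComp {x : V} (hx : x ∉ S) : ∃ D, IsComp G S D ∧ x ∈ D :=
  ⟨_, ⟨(G.induce Sᶜ).connectedComponentMk ⟨x, hx⟩, rfl⟩, ⟨x, hx⟩, rfl, rfl⟩

theorem IsComp.subset_of_nbhd_subset (hC : IsComp G S C) (hX : nbhd G X ⊆ S)
    (hne : (C ∩ X).Nonempty) : C ⊆ X := by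
  refine subset_of_preconnected_induce hC.preconnected hne fun a _ ha b hb hab => ?_
  by_contra hbX
  exact hC.subset_compl hb (hX ⟨hbX, a, ha, hab.symm⟩)

/-- `K` is a co-component of `G[A]`: the vertex set of a component of the complement of `G[A]`. -/
def IsCoComp (G : SimpleGraph V) (A K : Set V) : Prop := IsComp Gᶜ Aᶜ K

theorem IsCoComp.subset (h : IsCoComp G A K) : K ⊆ A := by
  simpa only [compl_compl] using IsComp.subset_compl h

theorem IsCoComp.nonempty (h : IsCoComp G A K) : K.Nonempty :=
  IsComp.nonempty h

theorem IsCoComp.preconnected (h : IsCoComp G A K) : (Gᶜ.induce K).Preconnected :=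
  IsComp.preconnected h

theorem IsCoComp.adj (h : IsCoComp G A K) {a b : V} (ha : a ∈ K) (hb : b ∈ A) (hbK : b ∉ K) :
    G.Adj a b := by
  by_contra hab
  have hne : a ≠ b := fun h => hbK (h ▸ ha)
  exact hbK (IsComp.mem_of_adj h ha ((G.compl_adj a b).2 ⟨hne, hab⟩) (not_not.2 hb))

theorem exists_isCoComp {x : V} (hx : x ∈ A) : ∃ K, IsCoComp G A K ∧ x ∈ K :=
  exists_isComp (not_not.2 hx)

end Connectivity

section FullComponents

variable {V : Type*} {G : SimpleGraph V} {A B S : Set V}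

theorem IsFullComp.exists_adj (h : IsFullComp G S A) {v : V} (hv : v ∈ S) : ∃ a ∈ A, G.Adj v a := by
  rw [← h.2] at hv
  exact hv.2

theorem IsFullComp.mem_or_mem_of_adj (h : IsFullComp G S A) {u v : V} (hu : u ∈ A)
    (huv : G.Adj u v) : v ∈ A ∨ v ∈ S := by
  by_contra! hv
  exact hv.1 (h.1.mem_of_adj hu huv hv.2)

theorem IsFullComp.disjoint (hA : IsFullComp G S A) (hB : IsFullComp G S B) (hAB : A ≠ B) :
    Disjoint A B :=
  Set.disjoint_left.2 fun _ ha hb => hAB (hA.1.eq_of_mem hB.1 ha hb)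

theorem IsFullComp.not_adj (hA : IsFullComp G S A) (hB : IsFullComp G S B) (hAB : A ≠ B) :
    ∀ a ∈ A, ∀ b ∈ B, ¬ G.Adj a b := fun _ ha _ hb hab =>
  Set.disjoint_left.1 (hA.disjoint hB hAB) (hA.1.mem_of_adj ha hab (hB.1.subset_compl hb)) hb

end FullComponents

section Modules

variable {V : Type*} {G : SimpleGraph V} {A M M' : Set V}

/-- `M` is a module of `G[A]`: each vertex of `A` outside `M` is adjacent to all vertices of `M` or
to none of them. -/
def IsModule (G : SimpleGraph V) (A M : Set V) : Prop :=
  M ⊆ A ∧ ∀ u ∈ A, u ∉ M → ∀ a ∈ M, ∀ b ∈ M, G.Adj u a → G.Adj u b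

theorem isModule_singleton {x : V} (hx : x ∈ A) : IsModule G A {x} :=
  ⟨Set.singleton_subset_iff.2 hx, by rintro u - - a rfl b rfl; exact id⟩

theorem IsModule.union (hM : IsModule G A M) (hM' : IsModule G A M') (hne : (M ∩ M').Nonempty) :
    IsModule G A (M ∪ M') := by
  obtain ⟨p, hp, hp'⟩ := hne
  refine ⟨Set.union_subset hM.1 hM'.1, fun u hu huMM' a ha b hb hua => ?_⟩
  obtain ⟨huM, huM'⟩ := not_or.1 huMM'
  have hup : G.Adj u p :=
    ha.elim (hM.2 u hu huM a · p hp hua) (hM'.2 u hu huM' a · p hp' hua)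
  exact hb.elim (hM.2 u hu huM p hp b · hup) (hM'.2 u hu huM' p hp' b · hup)

theorem IsModule.union_ne_of_preconnected (hA : (G.induce A).Preconnected)
    (hco : (Gᶜ.induce A).Preconnected) (hM : IsModule G A M) (hM' : IsModule G A M')
    (hMA : M ≠ A) (hMA' : M' ≠ A) : M ∪ M' ≠ A := by
  intro hun
  obtain ⟨q, hqA, hqM⟩ := Set.exists_of_ssubset (hM.1.ssubset_of_ne hMA)
  obtain ⟨w, hwA, hwM'⟩ := Set.exists_of_ssubset (hM'.1.ssubset_of_ne hMA')
  have mem_M : ∀ z ∈ A, z ∉ M' → z ∈ M := fun z hz => (hun ▸ hz : z ∈ M ∪ M').resolve_right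
  have hqM' : q ∈ M' := (hun ▸ hqA : q ∈ M ∪ M').resolve_left hqM
  obtain ⟨b, -, hb, a, haA, ha, hba⟩ := exists_adj_of_preconnected_induce hA hqA hqM' hwA hwM'
  obtain ⟨b', -, hb', a', haA', ha', hba'⟩ :=
    exists_adj_of_preconnected_induce hco hqA hqM' hwA hwM'
  have haq : G.Adj a q := hM'.2 a haA ha b hb q hqM' hba.symm
  have hqa' : G.Adj q a' := hM.2 q hqA hqM a (mem_M a haA ha) a' (mem_M a' haA' ha') haq.symm
  exact ((G.compl_adj _ _).1 hba').2 (hM'.2 a' haA' ha' q hqM' b' hb' hqa'.symm).symm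

theorem exists_adj_pair_forall_isModule_eq [Finite V] (hne : A.Nonempty)
    (hA : (G.induce A).Preconnected) (hco : (Gᶜ.induce A).Preconnected) :
    ∃ p ∈ A, ∃ q ∈ A, (p = q ∨ G.Adj p q) ∧
      ∀ M, IsModule G A M → p ∈ M → q ∈ M → M = A := by
  obtain ⟨x, hx⟩ := hne
  by_cases hsingle : {x} = A
  · exact ⟨x, hx, x, hx, Or.inl rfl, fun M hM hxM _ =>
      hM.1.antisymm (hsingle ▸ Set.singleton_subset_iff.2 hxM)⟩
  obtain ⟨M, ⟨hM, hMA, m, hm⟩, hmax⟩ :=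
    (Set.toFinite {M | IsModule G A M ∧ M ≠ A ∧ M.Nonempty}).exists_maximal
      ⟨{x}, isModule_singleton hx, hsingle, Set.singleton_nonempty x⟩
  obtain ⟨z, hzA, hzM⟩ := Set.exists_of_ssubset (hM.1.ssubset_of_ne hMA)
  obtain ⟨p, hpA, hpM, q, hqA, hqM, hpq⟩ :=
    exists_adj_of_preconnected_induce hA (hM.1 hm) hm hzA hzM
  refine ⟨p, hpA, q, hqA, Or.inr hpq, fun M' hM' hpM' hqM' => ?_⟩
  by_contra hMA'
  have hproper : M ∪ M' ≠ A := hM.union_ne_of_preconnected hA hco hM' hMA hMA'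
  exact hqM (hmax ⟨hM.union hM' ⟨p, hpM, hpM'⟩, hproper, p, Or.inl hpM⟩
    Set.subset_union_left (Or.inr hqM'))

end Modules

section Domination

variable {V : Type*} {G : SimpleGraph V} {A B K S X : Set V} {v : V}

theorem P6Free.not_induced_path (hG : P6Free G) {a b c d e f : V}
    (hab : G.Adj a b) (hac : ¬ G.Adj a c) (had : ¬ G.Adj a d) (hae : ¬ G.Adj a e)
    (haf : ¬ G.Adj a f) (hbc : G.Adj b c) (hbd : ¬ G.Adj b d) (hbe : ¬ G.Adj b e)
    (hbf : ¬ G.Adj b f) (hcd : G.Adj c d) (hce : ¬ G.Adj c e) (hcf : ¬ G.Adj c f)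
    (hde : G.Adj d e) (hdf : ¬ G.Adj d f) : ¬ G.Adj e f := by
  intro hef
  have adj_iff : ∀ i j : Fin 6, G.Adj (![a, b, c, d, e, f] i) (![a, b, c, d, e, f] j) ↔
      (SimpleGraph.pathGraph 6).Adj i j := by
    intro i j
    rw [SimpleGraph.pathGraph_adj]
    fin_cases i <;> fin_cases j <;> simp [*, G.adj_comm]
  refine hG ⟨⟨⟨![a, b, c, d, e, f], fun i j hij => ?_⟩, adj_iff _ _⟩⟩
  -- Distinct vertices of a path on six vertices have distinct neighbourhoods.
  have hnbr : ∀ k, (SimpleGraph.pathGraph 6).Adj i k ↔ (SimpleGraph.pathGraph 6).Adj j k := by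
    intro k
    rw [← adj_iff, ← adj_iff, hij]
  simp only [SimpleGraph.pathGraph_adj] at hnbr
  clear hij
  revert i j
  decide

/-- There is an induced path on four vertices that starts in `v` and continues in `A`. -/
def PathInto (G : SimpleGraph V) (v : V) (A : Set V) : Prop :=
  ∃ a ∈ A, ∃ b ∈ A, ∃ c ∈ A, G.Adj v a ∧ ¬ G.Adj v b ∧ ¬ G.Adj v c ∧
    G.Adj a b ∧ ¬ G.Adj a c ∧ G.Adj b c

/-- In `G[A]`, the neighbours of `v` are complete to the other vertices. -/
def SplitsAsJoin (G : SimpleGraph V) (v : V) (A : Set V) : Prop :=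
  ∀ a ∈ A, ∀ b ∈ A, G.Adj v a → ¬ G.Adj v b → G.Adj a b

theorem PathInto.adj (hp : PathInto G v B) (hG : P6Free G) (hA : (G.induce A).Preconnected)
    (hAB : ∀ a ∈ A, ∀ b ∈ B, ¬ G.Adj a b) (hv : ∃ a ∈ A, G.Adj v a) : ∀ a ∈ A, G.Adj v a := by
  intro a ha
  by_contra hva
  obtain ⟨a', ha', hva'⟩ := hv
  obtain ⟨x, hx, hvx, y, hy, hvy, hxy⟩ :=
    exists_adj_of_preconnected_induce (X := {z | G.Adj v z}) hA ha' hva' ha hva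
  obtain ⟨b, hb, c, hc, d, hd, hvb, hvc, hvd, hbc, hbd, hcd⟩ := hp
  exact hG.not_induced_path hxy.symm (fun h => hvy h.symm) (hAB y hy b hb) (hAB y hy c hc)
    (hAB y hy d hd) (SimpleGraph.Adj.symm hvx) (hAB x hx b hb) (hAB x hx c hc)
    (hAB x hx d hd) hvb hvc hvd hbc hbd hcd

theorem IsComp.isModule_of_not_pathInto (hK : IsComp G (A \ G.neighborSet v)ᶜ K)
    (hv : ¬ PathInto G v A) : IsModule G A K := by
  have hKA : K ⊆ A \ G.neighborSet v := by simpa only [compl_compl] using hK.subset_compl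
  refine ⟨fun a ha => (hKA ha).1, fun u hu huK a ha b hb hua => ?_⟩
  by_contra hub
  have hvu : G.Adj v u := by
    by_contra hvu
    exact huK (hK.mem_of_adj ha hua.symm (not_not.2 ⟨hu, hvu⟩))
  obtain ⟨c, hc, huc, e, he, hue, hce⟩ :=
    exists_adj_of_preconnected_induce (X := {z | G.Adj u z}) hK.preconnected ha hua hb hub
  exact hv ⟨u, hu, c, (hKA hc).1, e, (hKA he).1, hvu, (hKA hc).2, (hKA he).2, huc, hue, hce⟩

theorem exists_isComp_of_not_adj {p q : V} (hp : p ∈ A) (hq : q ∈ A) (hpq : p = q ∨ G.Adj p q)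
    (hvp : ¬ G.Adj v p) (hvq : ¬ G.Adj v q) :
    ∃ K, IsComp G (A \ G.neighborSet v)ᶜ K ∧ p ∈ K ∧ q ∈ K := by
  obtain ⟨K, hK, hpK⟩ := exists_isComp (G := G) (S := (A \ G.neighborSet v)ᶜ) (not_not.2 ⟨hp, hvp⟩)
  refine ⟨K, hK, hpK, ?_⟩
  rcases hpq with rfl | hpq
  · exact hpK
  · exact hK.mem_of_adj hpK hpq (not_not.2 ⟨hq, hvq⟩)

theorem exists_pair_of_preconnected_compl [Finite V] (hne : A.Nonempty)
    (hA : (G.induce A).Preconnected) (hco : (Gᶜ.induce A).Preconnected) :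
    ∃ p ∈ A, ∃ q ∈ A, ∀ v, (∃ a ∈ A, G.Adj v a) → G.Adj v p ∨ G.Adj v q ∨ PathInto G v A := by
  obtain ⟨p, hp, q, hq, hpq, hmodule⟩ := exists_adj_pair_forall_isModule_eq hne hA hco
  refine ⟨p, hp, q, hq, fun v ⟨a, ha, hva⟩ => ?_⟩
  by_contra! hcon
  obtain ⟨hvp, hvq, hpath⟩ := hcon
  obtain ⟨K, hK, hpK, hqK⟩ := exists_isComp_of_not_adj hp hq hpq hvp hvq
  rw [← hmodule K (hK.isModule_of_not_pathInto hpath) hpK hqK] at ha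
  exact not_not.1 (hK.subset_compl ha) |>.2 hva

theorem exists_pair_of_not_preconnected_compl (hco : ¬ (Gᶜ.induce A).Preconnected) :
    ∃ p ∈ A, ∃ q ∈ A, ∀ v, G.Adj v p ∨ G.Adj v q ∨ PathInto G v A ∨ SplitsAsJoin G v A := by
  have hne : A.Nonempty := by
    by_contra h
    rw [Set.not_nonempty_iff_eq_empty] at h
    subst h
    exact hco fun x => x.2.elim
  obtain ⟨p, hp⟩ := hne
  obtain ⟨L, hL, hpL⟩ := exists_isCoComp (G := G) hp
  obtain ⟨q, hq, hqL⟩ := Set.exists_of_ssubset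
    (hL.subset.ssubset_of_ne fun h => hco (h ▸ hL.preconnected))
  refine ⟨p, hp, q, hq, fun v => ?_⟩
  by_contra! hcon
  obtain ⟨hvp, hvq, hpath, hsplit⟩ := hcon
  obtain ⟨K, hK, hpK, hqK⟩ :=
    exists_isComp_of_not_adj hp hq (Or.inr (hL.adj hpL hq hqL)) hvp hvq
  have hmodule := hK.isModule_of_not_pathInto hpath
  have adj_K : ∀ u ∈ A, u ∉ K → ∀ a ∈ K, G.Adj u a := by
    intro u hu huK a ha
    by_cases huL : u ∈ L
    · exact hmodule.2 u hu huK q hqK a ha (hL.adj huL hq hqL)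
    · exact hmodule.2 u hu huK p hpK a ha (hL.adj hpL hu huL).symm
  have adj_v : ∀ u ∈ A, u ∉ K → G.Adj v u := by
    intro u hu huK
    by_contra hvu
    exact huK (hK.mem_of_adj hpK (adj_K u hu huK p hpK).symm (not_not.2 ⟨hu, hvu⟩))
  have not_adj_v : ∀ u ∈ K, ¬ G.Adj v u := fun u hu => (not_not.1 (hK.subset_compl hu)).2
  refine hsplit fun a ha b hb hva hvb => ?_
  exact adj_K a ha (fun h => not_adj_v a h hva) b (by_contra fun h => hvb (adj_v b hb h))

theorem exists_pair_of_preconnected [Finite V] (hne : A.Nonempty)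
    (hA : (G.induce A).Preconnected) :
    ∃ p ∈ A, ∃ q ∈ A, ∀ v, (∃ a ∈ A, G.Adj v a) →
      G.Adj v p ∨ G.Adj v q ∨ PathInto G v A ∨ SplitsAsJoin G v A := by
  by_cases hco : (Gᶜ.induce A).Preconnected
  · obtain ⟨p, hp, q, hq, h⟩ := exists_pair_of_preconnected_compl hne hA hco
    exact ⟨p, hp, q, hq, fun v hv => (h v hv).imp_right (Or.imp_right Or.inl)⟩
  · obtain ⟨p, hp, q, hq, h⟩ := exists_pair_of_not_preconnected_compl hco
    exact ⟨p, hp, q, hq, fun v _ => h v⟩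

theorem exists_dominating_pair_of_splitsAsJoin [Finite V] (hG : P6Free G)
    (hAB : ∀ a ∈ A, ∀ b ∈ B, ¬ G.Adj a b) {p q : V} (hp : p ∈ A) (hq : q ∈ B)
    (hpX : ∀ v ∈ X, ¬ G.Adj v p) (hqX : ∀ v ∈ X, ¬ G.Adj v q)
    (hNA : ∀ v ∈ X, ∃ a ∈ A, G.Adj v a) (hNB : ∀ v ∈ X, ∃ b ∈ B, G.Adj v b)
    (hXA : ∀ v ∈ X, SplitsAsJoin G v A) (hXB : ∀ v ∈ X, SplitsAsJoin G v B) :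
    ∃ a ∈ A, ∃ b ∈ B, ∀ w ∈ X, G.Adj w a ∨ G.Adj w b := by
  rcases X.eq_empty_or_nonempty with rfl | hX
  · exact ⟨p, hp, q, hq, fun w hw => hw.elim⟩
  obtain ⟨v, hv, hmin⟩ := X.toFinite.exists_minimalFor (fun v => {a ∈ A | G.Adj v a}) X hX
  obtain ⟨a, ha, hva⟩ := hNA v hv
  obtain ⟨b, hb, hvb⟩ := hNB v hv
  refine ⟨a, ha, b, hb, fun w hw => ?_⟩
  by_contra! hcon
  obtain ⟨hwa, hwb⟩ := hcon
  obtain ⟨c, hc, hwc, hvc⟩ : ∃ c ∈ A, G.Adj w c ∧ ¬ G.Adj v c := by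
    by_contra! h
    exact hwa (hmin hw (fun z hz => ⟨hz.1, h z hz.1 hz.2⟩) ⟨ha, hva⟩).2
  have hbq := hXB v hv b hb q hq hvb (hqX v hv)
  by_cases hvw : G.Adj v w
  · have hcp := hXA w hw c hc p hp hwc (hpX w hw)
    exact hG.not_induced_path hcp.symm (fun h => hpX w hw h.symm) (fun h => hpX v hv h.symm)
      (hAB p hp b hb) (hAB p hp q hq) hwc.symm (fun h => hvc h.symm) (hAB c hc b hb) (hAB c hc q hq)
      hvw.symm hwb (hqX w hw) hvb (hqX v hv) hbq
  · have hac := hXA v hv a ha c hc hva hvc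
    exact hG.not_induced_path hwc hwa (fun h => hvw h.symm) hwb (hqX w hw) hac.symm
      (fun h => hvc h.symm) (hAB c hc b hb) (hAB c hc q hq) hva.symm (hAB a ha b hb) (hAB a ha q hq)
      hvb (hqX v hv) hbq

theorem exists_ncard_le_six_dominating [Finite V] (hG : P6Free G) (hAne : A.Nonempty)
    (hBne : B.Nonempty) (hA : (G.induce A).Preconnected) (hB : (G.induce B).Preconnected)
    (hAB : ∀ a ∈ A, ∀ b ∈ B, ¬ G.Adj a b) (hNA : ∀ v ∈ S, ∃ a ∈ A, G.Adj v a)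
    (hNB : ∀ v ∈ S, ∃ b ∈ B, G.Adj v b) :
    ∃ Q ⊆ A ∪ B, Q.ncard ≤ 6 ∧ ∀ v ∈ S, ∃ q ∈ Q, G.Adj v q := by
  classical
  have hBA : ∀ b ∈ B, ∀ a ∈ A, ¬ G.Adj b a := fun b hb a ha h => hAB a ha b hb h.symm
  obtain ⟨p, hp, q, hq, hpq⟩ := exists_pair_of_preconnected hAne hA
  obtain ⟨p', hp', q', hq', hpq'⟩ := exists_pair_of_preconnected hBne hB
  let X : Set V := {v ∈ S | ¬ G.Adj v p ∧ ¬ G.Adj v q ∧ ¬ G.Adj v p' ∧ ¬ G.Adj v q'}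
  have hXA : ∀ v ∈ X, SplitsAsJoin G v A := fun v ⟨hv, hvp, hvq, hvp', _⟩ =>
    (((hpq v (hNA v hv)).resolve_left hvp).resolve_left hvq).resolve_left fun h =>
      hvp' (h.adj hG hB hBA (hNB v hv) p' hp')
  have hXB : ∀ v ∈ X, SplitsAsJoin G v B := fun v ⟨hv, hvp, _, hvp', hvq'⟩ =>
    (((hpq' v (hNB v hv)).resolve_left hvp').resolve_left hvq').resolve_left fun h =>
      hvp (h.adj hG hA hAB (hNA v hv) p hp)
  obtain ⟨a, ha, b, hb, hab⟩ := exists_dominating_pair_of_splitsAsJoin hG hAB hp hp'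
    (fun v hv => hv.2.1) (fun v hv => hv.2.2.2.1) (fun v hv => hNA v hv.1) (fun v hv => hNB v hv.1)
    hXA hXB
  refine ⟨({p, q, p', q', a, b} : Finset V), ?_, ?_, fun v hv => ?_⟩
  · simp [Set.insert_subset_iff, *]
  · exact (Set.ncard_coe_finset _).trans_le Finset.card_le_six
  · by_contra! hcon
    simp only [Finset.coe_insert, Finset.coe_singleton, Set.forall_mem_insert,
      Set.mem_singleton_iff, forall_eq] at hcon
    obtain ⟨hvp, hvq, hvp', hvq', hva, hvb⟩ := hcon
    exact (hab v ⟨hv, hvp, hvq, hvp', hvq'⟩).elim hva hvb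

end Domination

namespace RootedForest

variable {V : Type*} {T : RootedForest V} {X : Set V} {u v w : V} {d : ℕ}

theorem IsAncestor.mem_verts (h : T.IsAncestor u v) : u ∈ T.verts := by
  rcases Relation.ReflTransGen.cases_tail h.2 with rfl | ⟨w, -, hw⟩
  · exact h.1
  · exact (T.mem_of_parent w u hw).2

theorem IsAncestor.trans (huv : T.IsAncestor u v) (hvw : T.IsAncestor v w) : T.IsAncestor u w :=
  ⟨hvw.1, hvw.2.trans huv.2⟩

theorem IsAncestor.comparable (huw : T.IsAncestor u w) (hvw : T.IsAncestor v w) :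
    T.Comparable u v := by
  have hparent : Relator.RightUnique fun x y => T.parent x = some y := fun _ _ _ h h' =>
    Option.some.inj (h.symm.trans h')
  rcases Relation.ReflTransGen.total_of_right_unique hparent huw.2 hvw.2 with h | h
  · exact Or.inr ⟨huw.mem_verts, h⟩
  · exact Or.inl ⟨hvw.mem_verts, h⟩

theorem ncard_le_depth [Finite V] (hX : ∀ x ∈ X, T.IsAncestor x w) : X.ncard ≤ T.depth w :=
  Set.ncard_le_ncard hX

theorem ncard_le_of_inVerticalPath [Finite V] (hd : ∀ v ∈ T.verts, T.depth v ≤ d)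
    (hX : T.InVerticalPath X) : X.ncard ≤ d := by
  rcases hX with rfl | ⟨u, w, huw, hX⟩
  · simp
  · exact (ncard_le_depth fun x hx => (hX hx).2).trans (hd w huw.1)

theorem ncard_le_of_comparable [Finite V] (hd : ∀ v ∈ T.verts, T.depth v ≤ d)
    (hX : ∀ x ∈ X, ∀ y ∈ X, T.Comparable x y) : X.ncard ≤ d := by
  rcases X.eq_empty_or_nonempty with rfl | hne
  · simp
  obtain ⟨w, hw, hmax⟩ :=
    X.toFinite.exists_maximalFor (fun v => {u | T.IsAncestor u v}) X hne
  have hwT : w ∈ T.verts := (hX w hw w hw).elim And.left And.left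
  refine (ncard_le_depth fun x hx => ?_).trans (hd w hwT)
  rcases hX x hx w hw with hxw | hwx
  · exact hxw
  · exact hmax hx (fun u hu => hu.trans hwx) ⟨hwx.1, .refl⟩

theorem exists_isCoComp_ncard_le [Finite V] {G : SimpleGraph V} (hT : T.IsTDStructure G d)
    {A : Set V} (hA : A.Nonempty) :
    ∃ K, IsCoComp G A K ∧ ((A \ K) ∩ T.verts).ncard ≤ d := by
  by_cases hchain : ∀ x ∈ A ∩ T.verts, ∀ y ∈ A ∩ T.verts, T.Comparable x y
  · obtain ⟨x, hx⟩ := hA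
    obtain ⟨K, hK, -⟩ := exists_isCoComp (G := G) hx
    exact ⟨K, hK, ncard_le_of_comparable hT.1 fun x hx y hy =>
      hchain x ⟨hx.1.1, hx.2⟩ y ⟨hy.1.1, hy.2⟩⟩
  -- Two incomparable vertices share a co-component, and all vertices outside it are adjacent to
  -- both, hence ancestors of both.
  push Not at hchain
  obtain ⟨t, ⟨htA, htT⟩, t', ⟨htA', htT'⟩, hincomp⟩ := hchain
  obtain ⟨K, hK, htK⟩ := exists_isCoComp (G := G) htA
  have htK' : t' ∈ K := by
    by_contra h
    exact hincomp (hT.2 t htT t' htT' (hK.adj htK htA' h))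
  suffices h : ∀ z ∈ (A \ K) ∩ T.verts, T.IsAncestor z t from
    ⟨K, hK, (ncard_le_depth h).trans (hT.1 t htT)⟩
  rintro z ⟨⟨hzA, hzK⟩, hzT⟩
  refine (hT.2 t htT z hzT (hK.adj htK hzA hzK)).resolve_left fun htz => ?_
  rcases hT.2 t' htT' z hzT (hK.adj htK' hzA hzK) with htz' | hzt'
  · exact hincomp (htz.comparable htz')
  · exact hincomp (Or.inl (htz.trans hzt'))

end RootedForest

section Guesses

variable {V : Type*} {G : SimpleGraph V}

/-- The vertices that are neither in `Z` nor adjacent to a vertex of `Z`. -/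
def farFrom (G : SimpleGraph V) (Z : Set V) : Set V := {v | v ∉ Z ∧ ∀ z ∈ Z, ¬ G.Adj v z}

@[simp]
theorem farFrom_empty : farFrom G ∅ = Set.univ := by
  simp [farFrom]

@[simp]
theorem nbhd_univ : nbhd G Set.univ = ∅ := by
  simp [nbhd]

/-- The data determining a candidate separator `Guess.candidate`. The algorithm tries all guesses
whose sets have bounded size. -/
structure Guess (V : Type*) where
  /-- the set from which the closure procedure starts -/
  seed : Set V
  /-- vertices to which all vertices added by the closure procedure are adjacent -/
  seen : Set V
  /-- vertices from which all vertices added by the closure procedure are far -/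
  avoided : Set V
  /-- a set such that the neighbours of the vertices far from it belong to the candidate -/
  dominating : Set V
  /-- vertices added to the result of the closure procedure -/
  added : Set V
  /-- vertices that belong to the candidate -/
  kept : Set V
  /-- whether the closure procedure may add vertices without a neighbour in the current set -/
  skipAdj : Prop
  /-- whether the closure procedure may add vertices without a non-neighbour in the current set -/
  skipNonAdj : Prop

namespace Guess

variable {g : Guess V} {D X : Set V} {v : V}

/-- All sets of the guess have at most `m` elements. -/
def IsSmall (g : Guess V) (m : ℕ) : Prop :=
  g.seed.ncard ≤ m ∧ g.seen.ncard ≤ m ∧ g.avoided.ncard ≤ m ∧ g.dominating.ncard ≤ m ∧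
    g.added.ncard ≤ m ∧ g.kept.ncard ≤ m

/-- The part of the candidate that does not depend on the closure procedure. -/
def frame (G : SimpleGraph V) (g : Guess V) : Set V := nbhd G (farFrom G g.dominating) ∪ g.kept

/-- The vertices that the closure procedure may add. -/
def region (G : SimpleGraph V) (g : Guess V) : Set V :=
  {v | (∀ y ∈ g.seen, G.Adj v y) ∧ v ∈ farFrom G g.avoided ∧ v ∉ g.frame G}

/-- One round of the closure procedure. -/
def step (G : SimpleGraph V) (g : Guess V) (X : Set V) : Set V :=
  {v | v ∈ X ∨ v ∈ g.region G ∧ (g.skipAdj ∨ ∃ u ∈ X, G.Adj v u) ∧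
    (g.skipNonAdj ∨ ∃ u ∈ X, ¬ G.Adj v u)}

/-- The result of the closure procedure: for finite `V`, the least superset of the seed that is
closed under `step`. -/
def closure (G : SimpleGraph V) (g : Guess V) : Set V := (g.step G)^[Nat.card V] g.seed

/-- The candidate separator determined by a guess. -/
def candidate (G : SimpleGraph V) (g : Guess V) : Set V :=
  nbhd G (g.closure G ∪ g.added) ∪ g.frame G

theorem subset_step : X ⊆ g.step G X := fun _ => Or.inl

theorem iterate_step_subset {M : Set V} (hX : g.seed ⊆ M) (hM : g.step G M ⊆ M) (k : ℕ) :
    (g.step G)^[k] g.seed ⊆ M := by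
  induction k with
  | zero => exact hX
  | succ k ih =>
    rw [Function.iterate_succ_apply']
    refine Set.Subset.trans ?_ hM
    rintro v (hv | ⟨hv, hadj, hnadj⟩)
    · exact Or.inl (ih hv)
    · exact Or.inr ⟨hv, hadj.imp_right fun ⟨u, hu, h⟩ => ⟨u, ih hu, h⟩,
        hnadj.imp_right fun ⟨u, hu, h⟩ => ⟨u, ih hu, h⟩⟩

theorem closure_subset {M : Set V} (hX : g.seed ⊆ M)
    (hM : ∀ v ∈ g.region G, (g.skipAdj ∨ ∃ u ∈ M, G.Adj v u) →
      (g.skipNonAdj ∨ ∃ u ∈ M, ¬ G.Adj v u) → v ∈ M) : g.closure G ⊆ M :=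
  iterate_step_subset hX (fun v hv => hv.elim id fun h => hM v h.1 h.2.1 h.2.2) _

theorem monotone_iterate_step : Monotone fun k => (g.step G)^[k] X :=
  monotone_nat_of_le_succ fun k => by
    rw [Function.iterate_succ_apply']
    exact subset_step

theorem seed_subset_closure : g.seed ⊆ g.closure G :=
  monotone_iterate_step (Nat.zero_le _)

theorem step_closure [Finite V] : g.step G (g.closure G) = g.closure G := by
  have hstable : ∀ k, ((g.step G)^[k] g.seed).ncard = ((g.step G)^[k + 1] g.seed).ncard →
      (g.step G)^[k] g.seed = (g.step G)^[k + 1] g.seed := fun k h =>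
    Set.eq_of_subset_of_ncard_le (monotone_iterate_step k.le_succ) h.ge
  have hcard := Nat.stabilises_of_monotone (f := fun k => ((g.step G)^[k] g.seed).ncard)
    (fun _ _ h => Set.ncard_le_ncard (monotone_iterate_step h)) (fun _ => Set.ncard_le_card _)
    (fun k h => by
      have hstep := congrArg (g.step G) (hstable k h)
      simp only [← Function.iterate_succ_apply'] at hstep
      exact congrArg Set.ncard hstep)
    (Nat.card V).le_succ
  exact (Function.iterate_succ_apply' _ _ _).symm.trans (hstable _ hcard.symm).symm

theorem mem_closure [Finite V] (hv : v ∈ g.region G)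
    (hadj : g.skipAdj ∨ ∃ u ∈ g.closure G, G.Adj v u)
    (hnadj : g.skipNonAdj ∨ ∃ u ∈ g.closure G, ¬ G.Adj v u) : v ∈ g.closure G := by
  rw [← step_closure]
  exact Or.inr ⟨hv, hadj, hnadj⟩

/-- The guess with the given seed and avoided set in which all other sets are empty. -/
def ofSeed (X Z : Set V) (skipAdj skipNonAdj : Prop) : Guess V where
  seed := X
  seen := ∅
  avoided := Z
  dominating := ∅
  added := ∅
  kept := ∅
  skipAdj := skipAdj
  skipNonAdj := skipNonAdj

theorem region_ofSeed {Z : Set V} {b b' : Prop} : (ofSeed X Z b b').region G = farFrom G Z := by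
  simp [region, frame, ofSeed]

theorem candidate_ofSeed {Z : Set V} {b b' : Prop} :
    (ofSeed X Z b b').candidate G = nbhd G ((ofSeed X Z b b').closure G) := by
  simp [candidate, frame, ofSeed]

end Guess

end Guesses

section Candidates

variable {V : Type*} {G : SimpleGraph V} {A B D K P Q S S' X Z : Set V} {x y : V}

theorem ncard_pair_le (x y : V) : ({x, y} : Set V).ncard ≤ 2 :=
  (Set.ncard_insert_le _ _).trans (by rw [Set.ncard_singleton])

theorem IsFullComp.exists_dominating [Finite V] (hG : P6Free G) (hA : IsFullComp G S A)
    (hB : IsFullComp G S B) (hAB : A ≠ B) :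
    ∃ Q ⊆ A ∪ B, Q.ncard ≤ 6 ∧ ∀ v ∈ S, ∃ q ∈ Q, G.Adj v q :=
  exists_ncard_le_six_dominating hG hA.1.nonempty hB.1.nonempty hA.1.preconnected
    hB.1.preconnected (hA.not_adj hB hAB) (fun _ hv => hA.exists_adj hv)
    (fun _ hv => hB.exists_adj hv)

theorem IsFullComp.subset_farFrom (hA : IsFullComp G S A) (hB : IsFullComp G S B) (hAB : A ≠ B)
    (hZ : Z ⊆ B) : A ⊆ farFrom G Z := fun a ha =>
  ⟨fun haZ => Set.disjoint_left.1 (hA.disjoint hB hAB) ha (hZ haZ),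
    fun z hz => hA.not_adj hB hAB a ha z (hZ hz)⟩

theorem compl_subset_farFrom (hA : IsFullComp G S A) (hB : IsFullComp G S B) (hQ : Q ⊆ A ∪ B) :
    (A ∪ B ∪ S)ᶜ ⊆ farFrom G Q := by
  refine fun v hv => ⟨fun hvQ => hv (Or.inl (hQ hvQ)), fun q hq hvq => hv ?_⟩
  rcases hQ hq with hqA | hqB
  · exact (hA.mem_or_mem_of_adj hqA hvq.symm).imp_left Or.inl
  · exact (hB.mem_or_mem_of_adj hqB hvq.symm).imp_left Or.inr

theorem farFrom_eq_compl (hA : IsFullComp G S A) (hB : IsFullComp G S B) (hQ : Q ⊆ A ∪ B)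
    (hdom : ∀ v ∈ A ∪ B ∪ S, ∃ q ∈ Q, G.Adj v q) : farFrom G Q = (A ∪ B ∪ S)ᶜ := by
  refine Set.Subset.antisymm (fun v hv hvABS => ?_) (compl_subset_farFrom hA hB hQ)
  obtain ⟨q, hq, hvq⟩ := hdom v hvABS
  exact hv.2 q hq hvq

theorem nbhd_compl_subset (hA : IsFullComp G S A) (hB : IsFullComp G S B) :
    nbhd G (A ∪ B ∪ S)ᶜ ⊆ S := by
  rintro v ⟨hv, u, hu, hvu⟩
  rcases not_not.1 hv with (hvA | hvB) | hvS
  · exact (hu ((hA.mem_or_mem_of_adj hvA hvu).imp_left Or.inl)).elim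
  · exact (hu ((hB.mem_or_mem_of_adj hvB hvu).imp_left Or.inr)).elim
  · exact hvS

theorem exists_guess_of_isSubordinate [Finite V] (hG : P6Free G) (hS : IsSubordinate G S) :
    ∃ g : Guess V, g.IsSmall 6 ∧ g.candidate G = S := by
  obtain ⟨-, S', A, B, C, -, hAB, hA, hB, hSS', hC, hdisj⟩ := hS
  obtain ⟨Q, hQ, hcard, hdom⟩ := hA.exists_dominating hG hB hAB
  obtain ⟨c, hc⟩ := hC.1.nonempty
  have hfar : C ⊆ farFrom G Q := fun v hv => compl_subset_farFrom hA hB hQ fun h =>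
    Set.disjoint_left.1 hdisj hv (by rwa [Set.union_right_comm] at h)
  refine ⟨Guess.ofSeed {c} Q False True, by simpa [Guess.IsSmall, Guess.ofSeed], ?_⟩
  have hclosure : (Guess.ofSeed {c} Q False True).closure G = C := by
    apply Set.Subset.antisymm
    · refine Guess.closure_subset (Set.singleton_subset_iff.2 hc) fun v hv hadj _ => ?_
      rw [Guess.region_ofSeed] at hv
      obtain ⟨u, hu, hvu⟩ := hadj.resolve_left id
      refine (hC.mem_or_mem_of_adj hu hvu.symm).resolve_right fun hvS => ?_
      obtain ⟨q, hq, hvq⟩ := hdom v (hSS' hvS)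
      exact hv.2 q hq hvq
    · refine subset_of_preconnected_induce hC.1.preconnected
        ⟨c, hc, Guess.seed_subset_closure rfl⟩ fun a _ ha b hb hab => ?_
      exact Guess.mem_closure (Guess.region_ofSeed.symm ▸ hfar hb) (Or.inr ⟨a, ha, hab.symm⟩)
        (Or.inl trivial)
  rw [Guess.candidate_ofSeed, hclosure, hC.2]

theorem exists_pair_of_not_isMeshSet [Finite V] (hG : P6Free G) (hA : IsFullComp G S A)
    (hB : IsFullComp G S B) (hAB : A ≠ B) (hmB : ¬ IsMeshSet G B) :
    ∃ p ∈ B, ∃ q ∈ B, ∀ v ∈ S, v ∈ farFrom G {p, q} → ∀ a ∈ A, G.Adj v a := by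
  rw [isMeshSet_iff hB.1.nonempty, not_not] at hmB
  obtain ⟨p, hp, q, hq, hpq⟩ :=
    exists_pair_of_preconnected_compl hB.1.nonempty hB.1.preconnected hmB
  refine ⟨p, hp, q, hq, fun v hv hfar => ?_⟩
  rcases hpq v (hB.exists_adj hv) with hvp | hvq | hpath
  · exact (hfar.2 p (Or.inl rfl) hvp).elim
  · exact (hfar.2 q (Or.inr rfl) hvq).elim
  · exact hpath.adj hG hA.1.preconnected (hA.not_adj hB hAB) (hA.exists_adj hv)

theorem exists_guess_of_not_isMeshSet [Finite V] (hG : P6Free G) (hA : IsFullComp G S A)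
    (hB : IsFullComp G S B) (hAB : A ≠ B) (hmA : ¬ IsMeshSet G A) (hmB : ¬ IsMeshSet G B) :
    ∃ g : Guess V, g.IsSmall 2 ∧ g.candidate G = S := by
  rw [isMeshSet_iff hA.1.nonempty, not_not] at hmA
  obtain ⟨p, hp, q, hq, -, hmodule⟩ :=
    exists_adj_pair_forall_isModule_eq hA.1.nonempty hA.1.preconnected hmA
  obtain ⟨p', hp', q', hq', hcomplete⟩ := exists_pair_of_not_isMeshSet hG hA hB hAB hmB
  have hfar : A ⊆ farFrom G {p', q'} := hA.subset_farFrom hB hAB (Set.pair_subset hp' hq')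
  refine ⟨Guess.ofSeed {p, q} {p', q'} False False,
    by simp [Guess.IsSmall, Guess.ofSeed, ncard_pair_le], ?_⟩
  have hclosure : (Guess.ofSeed {p, q} {p', q'} False False).closure G = A := by
    refine hmodule _ ⟨?_, fun u hu huX a ha b hb hua => ?_⟩
      (Guess.seed_subset_closure (Or.inl rfl)) (Guess.seed_subset_closure (Or.inr rfl))
    · refine Guess.closure_subset (Set.pair_subset hp hq) fun v hv hadj hnadj => ?_
      rw [Guess.region_ofSeed] at hv
      obtain ⟨u, hu, hvu⟩ := hadj.resolve_left id
      obtain ⟨w, hw, hvw⟩ := hnadj.resolve_left id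
      exact (hA.mem_or_mem_of_adj hu hvu.symm).resolve_right fun hvS =>
        hvw (hcomplete v hvS hv w hw)
    · by_contra hub
      exact huX (Guess.mem_closure (Guess.region_ofSeed.symm ▸ hfar hu) (Or.inr ⟨a, ha, hua⟩)
        (Or.inr ⟨b, hb, hub⟩))
  rw [Guess.candidate_ofSeed, hclosure, hA.2]

theorem carvesAway_of_forall_ne (hB : IsComp G S B)
    (h : ∀ D, IsComp G S D → D ≠ B → CarvesAway G S S' D) : CarvesAway G S S' B :=
  fun C hC hCB D hD hne hCD => h D hD hne C hC hCD B hB hne.symm hCB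

theorem carvesAway_of_isolating (hA : IsComp G S A) (hXS : X ⊆ A ∪ S) (hAX : A ⊆ X ∪ nbhd G X)
    (hS' : nbhd G X ⊆ S') : CarvesAway G S S' A := by
  rintro C hC ⟨v, hvC, hvA⟩ D hD hDA ⟨w, hwC, hwD⟩
  have hvX : v ∈ X := (hAX hvA).resolve_right fun h => hC.subset_compl hvC (hS' h)
  rcases hXS (hC.subset_of_nbhd_subset hS' ⟨v, hvC, hvX⟩ hwC) with hwA | hwS
  · exact hDA (hD.eq_of_mem hA hwD hwA)
  · exact hD.subset_compl hwD hwS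

theorem carvesAway_of_nbhd_compl_subset (hA : IsFullComp G S A) (hB : IsFullComp G S B)
    (hcarve : CarvesAway G S S' A) (hS' : nbhd G (A ∪ B ∪ S)ᶜ ⊆ S') (hD : IsComp G S D) :
    CarvesAway G S S' D := by
  suffices h : ∀ E, IsComp G S E → E ≠ B → CarvesAway G S S' E by
    by_cases hDB : D = B
    · exact hDB ▸ carvesAway_of_forall_ne hB.1 h
    · exact h D hD hDB
  intro E hE hEB
  by_cases hEA : E = A
  · exact hEA ▸ hcarve
  have hEABS : E ⊆ (A ∪ B ∪ S)ᶜ := by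
    rintro v hv ((hvA | hvB) | hvS)
    · exact hEA (hE.eq_of_mem hA.1 hv hvA)
    · exact hEB (hE.eq_of_mem hB.1 hv hvB)
    · exact hE.subset_compl hv hvS
  rintro C hC hCE D' hD' hne ⟨w, hwC, hwD'⟩
  have hCABS := hC.subset_of_nbhd_subset hS' (hCE.mono (Set.inter_subset_inter_right C hEABS))
  have hCE' : C ⊆ E := subset_of_preconnected_induce hC.preconnected hCE fun _ _ ha b hb hab =>
    hE.mem_of_adj ha hab fun hbS => hCABS hb (Or.inr hbS)
  exact hne (hD'.eq_of_mem hE hwD' (hCE' hwC))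

theorem IsCoComp.adj_or_adj (hK : IsCoComp G A K) (hx : x ∈ K) (hy : y ∈ A \ K) :
    ∀ a ∈ A, G.Adj a x ∨ G.Adj a y := by
  intro a ha
  by_cases haK : a ∈ K
  · exact Or.inr (hK.adj haK hy.1 hy.2)
  · exact Or.inl (hK.adj hx ha haK).symm

theorem IsMeshSet.exists_mem_diff (hA : IsMeshSet G A) (hne : A.Nonempty) (hK : IsCoComp G A K) :
    ∃ y, y ∈ A \ K := by
  rw [isMeshSet_iff hne] at hA
  exact Set.exists_of_ssubset (hK.subset.ssubset_of_ne fun h => hA (h ▸ hK.preconnected))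

/-- The guess that isolates a mesh full component `A` of `S` with a co-component `K`, without
changing the intersection of the separator with `P`. Starting from `x ∈ K`, the closure procedure
adds vertices that see a chosen `y ∈ A \ K`, are far from the set `Z` in another full component, and
are outside the frame given by `Q`. -/
def coCompGuess (A K P S Z Q : Set V) (x y : V) : Guess V where
  seed := {x}
  seen := {y}
  avoided := Z
  dominating := Q
  added := insert y ((A \ K) ∩ P)
  kept := S ∩ P
  skipAdj := True
  skipNonAdj := False

namespace coCompGuess

theorem added_subset (hy : y ∈ A) : (coCompGuess A K P S Z Q x y).added ⊆ A :=
  Set.insert_subset hy fun _ hv => hv.1.1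

theorem region_subset (hA : IsFullComp G S A) (hy : y ∈ A) :
    (coCompGuess A K P S Z Q x y).region G ⊆ A ∪ S := fun _ hv =>
  hA.mem_or_mem_of_adj hy (hv.1 y rfl).symm

theorem frame_subset (hQ : nbhd G (farFrom G Q) ⊆ S) :
    (coCompGuess A K P S Z Q x y).frame G ⊆ S :=
  Set.union_subset hQ Set.inter_subset_left

theorem subset_region (hA : IsFullComp G S A) (hB : IsFullComp G S B) (hAB : A ≠ B) (hZ : Z ⊆ B)
    (hQ : nbhd G (farFrom G Q) ⊆ S) (hK : IsCoComp G A K) (hy : y ∈ A \ K) :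
    K ⊆ (coCompGuess A K P S Z Q x y).region G := fun _ ha =>
  ⟨fun _ h => h.symm ▸ hK.adj ha hy.1 hy.2, hA.subset_farFrom hB hAB hZ (hK.subset ha),
    fun h => hA.1.subset_compl (hK.subset ha) (frame_subset hQ h)⟩

theorem isSmall {d : ℕ} (hK : ((A \ K) ∩ P).ncard ≤ d) (hS : (S ∩ P).ncard ≤ d)
    (hZ : Z.ncard ≤ d + 10) (hQ : Q.ncard ≤ d + 10) :
    (coCompGuess A K P S Z Q x y).IsSmall (d + 10) := by
  have hadded := Set.ncard_insert_le y ((A \ K) ∩ P)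
  simp only [Guess.IsSmall, coCompGuess, Set.ncard_singleton]
  lia

variable [Finite V]

theorem subset_closure (hK : IsCoComp G A K) (hx : x ∈ K)
    (hregion : K ⊆ (coCompGuess A K P S Z Q x y).region G) :
    K ⊆ (coCompGuess A K P S Z Q x y).closure G :=
  subset_of_preconnected_induce hK.preconnected ⟨x, hx, Guess.seed_subset_closure rfl⟩
    fun a _ ha _ hb hab => Guess.mem_closure (hregion hb) (Or.inl trivial)
      (Or.inr ⟨a, ha, fun h => ((G.compl_adj _ _).1 hab).2 h.symm⟩)

theorem carvesAway_candidate (hA : IsFullComp G S A) (hK : IsCoComp G A K) (hx : x ∈ K)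
    (hy : y ∈ A \ K) (hregion : K ⊆ (coCompGuess A K P S Z Q x y).region G) :
    CarvesAway G S ((coCompGuess A K P S Z Q x y).candidate G) A := by
  have hKclosure := subset_closure hK hx hregion
  refine carvesAway_of_isolating (X := _ ∪ (coCompGuess A K P S Z Q x y).added) hA.1
    (Set.union_subset (Guess.closure_subset ?_ fun v hv _ _ => region_subset hA hy.1 hv)
      ((added_subset hy.1).trans Set.subset_union_left)) (fun a ha => ?_) Set.subset_union_left
  · exact Set.singleton_subset_iff.2 (Or.inl (hK.subset hx))
  · refine or_iff_not_imp_left.2 fun haX => ⟨haX, ?_⟩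
    rcases hK.adj_or_adj hx hy a ha with hax | hay
    · exact ⟨x, Or.inl (hKclosure hx), hax⟩
    · exact ⟨y, Or.inr (Or.inl rfl), hay⟩

theorem candidate_inter (hA : IsFullComp G S A) (hQ : nbhd G (farFrom G Q) ⊆ S)
    (hK : IsCoComp G A K) (hx : x ∈ K) (hy : y ∈ A)
    (hregion : K ⊆ (coCompGuess A K P S Z Q x y).region G)
    (hN : ∀ u ∈ (coCompGuess A K P S Z Q x y).closure G, ∀ v ∈ P, G.Adj u v → v ∈ A ∨ v ∈ S) :
    (coCompGuess A K P S Z Q x y).candidate G ∩ P = S ∩ P := by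
  refine Set.Subset.antisymm ?_ fun v hv => ⟨Or.inr (Or.inr hv), hv.2⟩
  rintro v ⟨⟨hv, u, hu, hvu⟩ | hv, hvP⟩
  · have hvA : v ∉ A := fun hvA => hv <| by
      by_cases hvK : v ∈ K
      · exact Or.inl (subset_closure hK hx hregion hvK)
      · exact Or.inr (Or.inr ⟨⟨hvA, hvK⟩, hvP⟩)
    have hvAS : v ∈ A ∨ v ∈ S := by
      rcases hu with hu | hu
      · exact hN u hu v hvP hvu.symm
      · exact hA.mem_or_mem_of_adj (added_subset hy hu) hvu.symm
    exact ⟨hvAS.resolve_left hvA, hvP⟩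
  · exact ⟨frame_subset hQ hv, hvP⟩

end coCompGuess

theorem exists_guess_of_mixed [Finite V] (hG : P6Free G) {d : ℕ} (hA : IsFullComp G S A)
    (hB : IsFullComp G S B) (hAB : A ≠ B) (hmA : IsMeshSet G A) (hmB : ¬ IsMeshSet G B)
    (hK : IsCoComp G A K) (hKP : ((A \ K) ∩ P).ncard ≤ d) (hSP : (S ∩ P).ncard ≤ d) :
    ∃ g : Guess V, g.IsSmall (d + 10) ∧ g.candidate G ∩ P = S ∩ P ∧
      CarvesAway G S (g.candidate G) A := by
  obtain ⟨x, hx⟩ := hK.nonempty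
  obtain ⟨y, hy⟩ := hmA.exists_mem_diff hA.1.nonempty hK
  obtain ⟨p, hp, q, hq, hcomplete⟩ := exists_pair_of_not_isMeshSet hG hA hB hAB hmB
  have hQ : nbhd G (farFrom G ∅) ⊆ S := by simp
  have hregion := coCompGuess.subset_region (x := x) (P := P) hA hB hAB (Set.pair_subset hp hq) hQ
    hK hy
  have hclosure : (coCompGuess A K P S {p, q} ∅ x y).closure G ⊆ K := by
    refine Guess.closure_subset (Set.singleton_subset_iff.2 hx) fun v hv _ hnadj => ?_
    obtain ⟨u, hu, hvu⟩ := hnadj.resolve_left id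
    rcases coCompGuess.region_subset hA hy.1 hv with hvA | hvS
    · by_contra hvK
      exact hvu (hK.adj hu hvA hvK).symm
    · exact (hvu (hcomplete v hvS hv.2.1 u (hK.subset hu))).elim
  refine ⟨coCompGuess A K P S {p, q} ∅ x y, coCompGuess.isSmall hKP hSP
    ((ncard_pair_le p q).trans (by lia)) (by simp), ?_,
    coCompGuess.carvesAway_candidate hA hK hx hy hregion⟩
  exact coCompGuess.candidate_inter hA hQ hK hx hy.1 hregion fun u hu v _ huv =>
    hA.mem_or_mem_of_adj (hK.subset (hclosure hu)) huv

theorem exists_frame_of_mesh [Finite V] (hG : P6Free G) {K L : Set V} (hA : IsFullComp G S A)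
    (hB : IsFullComp G S B) (hAB : A ≠ B) (hK : IsCoComp G A K) (hL : IsCoComp G B L)
    {x' y' : V} (hx : x ∈ K) (hy : y ∈ A \ K) (hx' : x' ∈ L) (hy' : y' ∈ B \ L) :
    ∃ Q : Set V, Q.ncard ≤ 10 ∧ farFrom G Q = (A ∪ B ∪ S)ᶜ := by
  obtain ⟨Q, hQ, hcard, hdom⟩ := hA.exists_dominating hG hB hAB
  refine ⟨{x, y} ∪ {x', y'} ∪ Q, ?_, farFrom_eq_compl hA hB ?_ ?_⟩
  · have h₁ := Set.ncard_union_le ({x, y} ∪ {x', y'}) Q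
    have h₂ := Set.ncard_union_le {x, y} {x', y'}
    have h₃ := ncard_pair_le x y
    have h₄ := ncard_pair_le x' y'
    lia
  · exact Set.union_subset (Set.union_subset_union (Set.pair_subset (hK.subset hx) hy.1)
      (Set.pair_subset (hL.subset hx') hy'.1)) hQ
  · rintro v ((hvA | hvB) | hvS)
    · rcases hK.adj_or_adj hx hy v hvA with h | h
      · exact ⟨x, by simp, h⟩
      · exact ⟨y, by simp, h⟩
    · rcases hL.adj_or_adj hx' hy' v hvB with h | h
      · exact ⟨x', by simp, h⟩
      · exact ⟨y', by simp, h⟩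
    · obtain ⟨q, hq, hvq⟩ := hdom v hvS
      exact ⟨q, Or.inr hq, hvq⟩

theorem adj_of_adj_isCoComp (hG : P6Free G) {L : Set V} (hA : IsFullComp G S A)
    (hB : IsFullComp G S B) (hAB : A ≠ B) (hL : IsCoComp G B L) {b b' u v : V} (hb : b ∈ L)
    (hb' : b' ∈ B \ L) (hu : u ∈ S) (huL : ∃ c ∈ L, G.Adj u c) (hub : ¬ G.Adj u b)
    (hub' : ¬ G.Adj u b') (hv : v ∈ A ∪ S) (hvL : ∀ c ∈ L, ¬ G.Adj v c) (hvb' : ¬ G.Adj v b') :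
    G.Adj u v := by
  obtain ⟨c, hc, huc⟩ := huL
  obtain ⟨s, hs, hus, t, ht, hut, hst⟩ :=
    exists_adj_of_preconnected_induce (X := {z | G.Adj u z}) hL.preconnected hc huc hb hub
  have hst' : ¬ G.Adj s t := ((G.compl_adj s t).1 hst).2
  have hsb' : G.Adj s b' := hL.adj hs hb'.1 hb'.2
  have htb' : G.Adj t b' := hL.adj ht hb'.1 hb'.2
  have hpath : PathInto G u B := ⟨s, hL.subset hs, b', hb'.1, t, hL.subset ht, hus, hub', hut, hsb',
    hst', htb'.symm⟩
  have huA := hpath.adj hG hA.1.preconnected (hA.not_adj hB hAB) (hA.exists_adj hu)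
  rcases hv with hv | hv
  · exact huA v hv
  · obtain ⟨a, ha, hva⟩ := hA.exists_adj hv
    have not_adj_a := hA.not_adj hB hAB a ha
    by_contra huv
    exact hG.not_induced_path hva (fun h => huv h.symm) (hvL s hs) hvb' (hvL t ht)
      (huA a ha).symm (not_adj_a s (hL.subset hs)) (not_adj_a b' hb'.1)
      (not_adj_a t (hL.subset ht)) hus hub' hut hsb' hst' htb'.symm

theorem closure_coCompGuess_subset (hG : P6Free G) {L : Set V} (hA : IsFullComp G S A)
    (hB : IsFullComp G S B) (hAB : A ≠ B) (hL : IsCoComp G B L) {b b' : V} (hb : b ∈ L)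
    (hb' : b' ∈ B \ L) (hx : x ∈ A) (hy : y ∈ A) (hbZ : b ∈ Z) (hbZ' : b' ∈ Z)
    (hregion : x ∈ (coCompGuess A K P S Z Q x y).region G) :
    (coCompGuess A K P S Z Q x y).closure G ⊆
      {v | v ∈ (coCompGuess A K P S Z Q x y).region G ∧ ∀ c ∈ L, ¬ G.Adj v c} := by
  refine Guess.closure_subset (Set.singleton_subset_iff.2
    ⟨hregion, fun c hc => hA.not_adj hB hAB x hx c (hL.subset hc)⟩) fun v hv _ hnadj => ?_
  obtain ⟨u, ⟨hu, huL⟩, hvu⟩ := hnadj.resolve_left id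
  refine ⟨hv, ?_⟩
  by_contra! hvL
  have hvS : v ∈ S := (coCompGuess.region_subset hA hy hv).resolve_left fun hvA =>
    hvL.elim fun c hc => hA.not_adj hB hAB v hvA c (hL.subset hc.1) hc.2
  exact hvu (adj_of_adj_isCoComp hG hA hB hAB hL hb hb' hvS hvL (hv.2.1.2 b hbZ)
    (hv.2.1.2 b' hbZ') (coCompGuess.region_subset hA hy hu) huL (hu.2.1.2 b' hbZ'))

theorem exists_guess_of_mesh [Finite V] (hG : P6Free G) {L : Set V} {d : ℕ}
    (hA : IsFullComp G S A) (hB : IsFullComp G S B) (hAB : A ≠ B) (hmA : IsMeshSet G A)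
    (hmB : IsMeshSet G B) (hK : IsCoComp G A K) (hKP : ((A \ K) ∩ P).ncard ≤ d)
    (hL : IsCoComp G B L) (hLP : ((B \ L) ∩ P).ncard ≤ d) (hSP : (S ∩ P).ncard ≤ d) :
    ∃ g : Guess V, g.IsSmall (d + 10) ∧ g.candidate G ∩ P = S ∩ P ∧
      ∀ D, IsComp G S D → CarvesAway G S (g.candidate G) D := by
  obtain ⟨x, hx⟩ := hK.nonempty
  obtain ⟨y, hy⟩ := hmA.exists_mem_diff hA.1.nonempty hK
  obtain ⟨x', hx'⟩ := hL.nonempty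
  obtain ⟨y', hy'⟩ := hmB.exists_mem_diff hB.1.nonempty hL
  obtain ⟨Q, hQcard, hQ⟩ := exists_frame_of_mesh hG hA hB hAB hK hL hx hy hx' hy'
  set Z : Set V := insert x' (insert y' ((B \ L) ∩ P)) with hZ
  have hZcard : Z.ncard ≤ d + 10 := by
    have h₁ := Set.ncard_insert_le x' (insert y' ((B \ L) ∩ P))
    have h₂ := Set.ncard_insert_le y' ((B \ L) ∩ P)
    lia
  have hZB : Z ⊆ B :=
    Set.insert_subset (hL.subset hx') (Set.insert_subset hy'.1 fun _ hv => hv.1.1)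
  have hQS : nbhd G (farFrom G Q) ⊆ S := hQ ▸ nbhd_compl_subset hA hB
  have hregion := coCompGuess.subset_region (x := x) (P := P) hA hB hAB hZB hQS hK hy
  have hclosure := closure_coCompGuess_subset hG hA hB hAB hL hx' hy' (hK.subset hx) hy.1
    (by simp [hZ]) (by simp [hZ]) (hregion hx)
  refine ⟨coCompGuess A K P S Z Q x y, coCompGuess.isSmall hKP hSP hZcard (by lia), ?_,
    fun D => carvesAway_of_nbhd_compl_subset hA hB
      (coCompGuess.carvesAway_candidate hA hK hx hy hregion) ?_⟩
  · refine coCompGuess.candidate_inter hA hQS hK hx hy.1 hregion fun u hu v hvP huv => ?_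
    obtain ⟨hureg, huL⟩ := hclosure hu
    rcases coCompGuess.region_subset hA hy.1 hureg with huA | huS
    · exact hA.mem_or_mem_of_adj huA huv
    by_contra! hvAS
    by_cases hvB : v ∈ B
    · by_cases hvL : v ∈ L
      · exact huL v hvL huv
      · exact hureg.2.1.2 v (Or.inr (Or.inr ⟨⟨hvB, hvL⟩, hvP⟩)) huv
    · refine hureg.2.2 (Or.inl ⟨fun h => (hQ ▸ h) (Or.inr huS), v, ?_, huv⟩)
      simpa [coCompGuess, hQ] using ⟨⟨hvAS.1, hvB⟩, hvAS.2⟩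
  · exact fun v hv => Or.inr (Or.inl (by simpa [coCompGuess, hQ] using hv))

end Candidates

section Carvers

variable {V : Type*} {G : SimpleGraph V} {T : RootedForest V} {A S S' : Set V} {d : ℕ}

theorem isCarver_self (h : IsSubordinate G S ∨ meshFullComps G S = ∅) : T.IsCarver G S S := by
  have not_of_encard_ne_zero : ¬ (¬ IsSubordinate G S ∧ (meshFullComps G S).encard ≠ 0) :=
    fun hS => h.elim hS.1 fun hempty => hS.2 (Set.encard_eq_zero.2 hempty)
  exact ⟨rfl, fun _ => rfl, fun hS => (not_of_encard_ne_zero ⟨hS.2.1, by simp [hS.2.2]⟩).elim,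
    fun hS => (not_of_encard_ne_zero ⟨hS.2.1, by simp [hS.2.2]⟩).elim⟩

theorem isCarver_of_carvesAway (hsub : ¬ IsSubordinate G S) (hA : A ∈ meshFullComps G S)
    (hT : S' ∩ T.verts = S ∩ T.verts) (hcarve : ∀ B ∈ meshFullComps G S, CarvesAway G S S' B)
    (hmesh : IsMeshSep G S → ∀ D, IsComp G S D → CarvesAway G S S' D) : T.IsCarver G S S' := by
  refine ⟨hT, ?_, fun _ B hB hmB => hcarve B ⟨hB, hmB⟩, hmesh⟩
  rintro (h | h)
  · exact (hsub h).elim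
  · exact ((Set.encard_eq_zero.1 h.2.2).le hA).elim

theorem Guess.IsSmall.mono {g : Guess V} {m k : ℕ} (hg : g.IsSmall m) (hmk : m ≤ k) :
    g.IsSmall k := by
  simp only [Guess.IsSmall] at hg ⊢
  lia

theorem exists_guess_isCarver_of_mem_meshFullComps [Finite V] (hG : P6Free G)
    (hT : T.IsTDStructure G d) (hS : IsMinSep G S) (hST : (S ∩ T.verts).ncard ≤ d)
    (hsub : ¬ IsSubordinate G S) (hA : A ∈ meshFullComps G S) :
    ∃ g : Guess V, g.IsSmall (d + 10) ∧ T.IsCarver G S (g.candidate G) := by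
  obtain ⟨K, hK, hKT⟩ := RootedForest.exists_isCoComp_ncard_le hT hA.1.1.nonempty
  by_cases hmesh : ∃ B ∈ meshFullComps G S, A ≠ B
  · obtain ⟨B, hB, hAB⟩ := hmesh
    obtain ⟨L, hL, hLT⟩ := RootedForest.exists_isCoComp_ncard_le hT hB.1.1.nonempty
    obtain ⟨g, hg, hgT, hcarve⟩ :=
      exists_guess_of_mesh hG hA.1 hB.1 hAB hA.2 hB.2 hK hKT hL hLT hST
    exact ⟨g, hg, isCarver_of_carvesAway hsub hA hgT (fun D hD => hcarve D hD.1.1) fun _ => hcarve⟩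
  · push Not at hmesh
    obtain ⟨B, hB, hAB⟩ : ∃ B, IsFullComp G S B ∧ A ≠ B := by
      obtain ⟨B, B', hBB', hB, hB'⟩ := hS
      by_cases hAB : A = B
      · exact ⟨B', hB', hAB ▸ hBB'⟩
      · exact ⟨B, hB, hAB⟩
    obtain ⟨g, hg, hgT, hcarve⟩ :=
      exists_guess_of_mixed hG hA.1 hB hAB hA.2 (fun hmB => hAB (hmesh B ⟨hB, hmB⟩)) hK hKT hST
    refine ⟨g, hg, isCarver_of_carvesAway hsub hA hgT (fun D hD => hmesh D hD ▸ hcarve)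
      fun hS₂ => ?_⟩
    obtain ⟨D, D', hne, heq⟩ := Set.encard_eq_two.1 hS₂.2.2
    exact (hne ((hmesh D (by simp [heq])).symm.trans (hmesh D' (by simp [heq])))).elim

theorem exists_guess_isCarver [Finite V] (hG : P6Free G) (hT : T.IsTDStructure G d)
    (hS : IsMinSep G S) (hST : (S ∩ T.verts).ncard ≤ d) :
    ∃ g : Guess V, g.IsSmall (d + 10) ∧ T.IsCarver G S (g.candidate G) := by
  by_cases hsub : IsSubordinate G S
  · obtain ⟨g, hg, rfl⟩ := exists_guess_of_isSubordinate hG hsub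
    exact ⟨g, hg.mono (by lia), isCarver_self (Or.inl hsub)⟩
  rcases (meshFullComps G S).eq_empty_or_nonempty with hempty | ⟨A, hA⟩
  · have not_mesh : ∀ D, IsFullComp G S D → ¬ IsMeshSet G D := fun D hD hmD => hempty.le ⟨hD, hmD⟩
    obtain ⟨A, B, hAB, hA, hB⟩ := hS
    obtain ⟨g, hg, rfl⟩ :=
      exists_guess_of_not_isMeshSet hG hA hB hAB (not_mesh A hA) (not_mesh B hB)
    exact ⟨g, hg.mono (by lia), isCarver_self (Or.inr hempty)⟩
  · exact exists_guess_isCarver_of_mem_meshFullComps hG hT hS hST hsub hA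

end Carvers

section Triples

/-- A Hoare triple with a time bound: started in a state satisfying `P`, the program `c` halts after
at most `t` steps, in a state satisfying `Q`. -/
def Triple (P : State → Prop) (c : Prog) (t : ℕ) (Q : State → Prop) : Prop :=
  ∀ s, P s → ∃ t' ≤ t, ∃ s', Exec c s t' s' ∧ Q s'

/-- The state with the variable `x` set to `k`. -/
def State.setVar (s : State) (x k : ℕ) : State := { s with var := Function.update s.var x k }

/-- The program `for x := 0, …, n + k - 1 do c`, where `n` is the value of the variable `0`. -/
def forProg (x k : ℕ) (c : Prog) : Prog :=
  .seq (.assign x (.const 0)) (.loop (.lt (.var x) (.add (.var 0) (.const k)))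
    (.seq c (.assign x (.add (.var x) (.const 1)))))

variable {P Q R : State → Prop} {c c' : Prog} {t t' : ℕ}

theorem Triple.seq (h : Triple P c t Q) (h' : Triple Q c' t' R) :
    Triple P (.seq c c') (t + t') R := by
  intro s hs
  obtain ⟨t₁, ht₁, s₁, hex₁, hs₁⟩ := h s hs
  obtain ⟨t₂, ht₂, s₂, hex₂, hs₂⟩ := h' s₁ hs₁
  exact ⟨t₁ + t₂, Nat.add_le_add ht₁ ht₂, s₂, hex₁.seq hex₂, hs₂⟩

theorem triple_iteSkip {e : Expr} (h : Triple (fun s => P s ∧ e.eval s ≠ 0) c t Q)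
    (hskip : ∀ s, P s → e.eval s = 0 → Q s) :
    Triple P (.ite e c .skip) (e.cost + 1 + (t + 1)) Q := by
  intro s hs
  by_cases he : e.eval s = 0
  · exact ⟨_, by lia, s, .ite_false he (.skip s), hskip s hs he⟩
  · obtain ⟨t', ht', s', hex, hs'⟩ := h s ⟨hs, he⟩
    exact ⟨_, by lia, s', .ite_true he hex, hs'⟩

theorem triple_loop {x k N : ℕ} (I : ℕ → State → Prop)
    (hI : ∀ i s, I i s → s.var x = i ∧ s.var 0 + k = N)
    (hstep : ∀ i < N, Triple (I i) c t fun s => s.var x = i ∧ I (i + 1) (s.setVar x (i + 1)))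
    (j : ℕ) : ∀ i, i + j = N → Triple (I i) (.loop (.lt (.var x) (.add (.var 0) (.const k)))
      (.seq c (.assign x (.add (.var x) (.const 1))))) (j * (t + 10) + 6) (I N) := by
  induction j with
  | zero =>
    intro i hi s hs
    have hx := hI i s hs
    refine ⟨6, by lia, s, .loop_false ?_, hi ▸ hs⟩
    simp only [Expr.eval]
    exact if_neg (by lia)
  | succ j ih =>
    intro i hi s hs
    have hx := hI i s hs
    obtain ⟨t₁, ht₁, s₁, hex₁, hx₁, hs₁⟩ := hstep i (by lia) s hs
    obtain ⟨t₂, ht₂, s₂, hex₂, hs₂⟩ := ih (i + 1) (by lia) _ hs₁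
    have hlt : s.var x < s.var 0 + k := by lia
    have htest : (Expr.lt (.var x) (.add (.var 0) (.const k))).eval s ≠ 0 := by
      simp [Expr.eval, hlt]
    have hincr : s₁.setVar x (i + 1) =
        { s₁ with var := Function.update s₁.var x ((Expr.add (.var x) (.const 1)).eval s₁) } := by
      simp only [State.setVar, Expr.eval, hx₁]
    rw [hincr] at hex₂
    refine ⟨_, ?_, s₂, .loop_true htest (hex₁.seq (.assign _ _ _)) hex₂, hs₂⟩
    simp only [Expr.cost]
    lia

theorem triple_forProg {x k N : ℕ} (I : ℕ → State → Prop)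
    (hI : ∀ i s, I i s → s.var x = i ∧ s.var 0 + k = N)
    (hstep : ∀ i < N, Triple (I i) c t fun s => s.var x = i ∧ I (i + 1) (s.setVar x (i + 1))) :
    Triple (fun s => I 0 (s.setVar x 0)) (forProg x k c) (N * (t + 10) + 8) (I N) := by
  intro s hs
  obtain ⟨t', ht', s', hex, hs'⟩ := triple_loop I hI hstep N 0 (Nat.zero_add N) _ hs
  exact ⟨_, by simp only [Expr.cost]; lia, s', (Exec.assign x (.const 0) s).seq hex, hs'⟩

end Triples

/-- The vertex sets that the algorithm keeps in memory. -/
inductive Reg where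
  /-- the vertices in or next to the dominating set of the guess -/
  | near
  /-- the frame of the guess -/
  | frame
  /-- the vertices outside the region of the guess -/
  | blocked
  /-- the current set of the closure procedure -/
  | current
  /-- the vertices that the flag `skipAdj` of the guess or a neighbour in `current` admits -/
  | adjacent
  /-- the vertices that the flag `skipNonAdj` of the guess or a non-neighbour in `current` admits -/
  | nonadjacent
  /-- the set that replaces `current` -/
  | next
  /-- the candidate separator -/
  | separator
  deriving DecidableEq

/-- An abstract memory state of the algorithm on a graph with vertex set `Fin n`. -/
structure Config (n : ℕ) where
  /-- numerical parameters -/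
  par : ℕ → ℕ
  /-- vertex sets -/
  reg : Reg → Set (Fin n)
  /-- the sets output so far -/
  out : Set (Set (Fin n))

namespace Config

variable {n : ℕ}

/-- Change a numerical parameter. -/
def setPar (κ : Config n) (x k : ℕ) : Config n := { κ with par := Function.update κ.par x k }

/-- Change a vertex set. -/
def setReg (κ : Config n) (r : Reg) (X : Set (Fin n)) : Config n :=
  { κ with reg := Function.update κ.reg r X }

/-- Output the set `r`. -/
def emit (κ : Config n) (r : Reg) : Config n := { κ with out := insert (κ.reg r) κ.out }

end Config

/-- The array holding the characteristic function of the vertex set `r`; array `0` holds the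
adjacency matrix. -/
def Reg.array (r : Reg) : ℕ := r.ctorIdx + 1

theorem Reg.array_injective : Function.Injective Reg.array := by
  intro r r' h
  cases r <;> cases r' <;> first | rfl | cases h

/-- The machine state `s` stores the graph `G` and the abstract memory state `κ`. The variable `0`
is the number of vertices, the variables `1` and `2` are used to loop over vertices, and the
remaining ones are the parameters. -/
structure Represents {n : ℕ} (G : SimpleGraph (Fin n)) (κ : Config n) (s : State) : Prop where
  var_zero : s.var 0 = n
  adj_iff : ∀ u v : Fin n, s.arr 0 u v ≠ 0 ↔ G.Adj u v
  mem_reg_iff : ∀ (r : Reg) (v : Fin n), s.arr r.array v 0 ≠ 0 ↔ v ∈ κ.reg r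
  var_add_three : ∀ x, s.var (x + 3) = κ.par x
  outputs : OutputsFamily s.out κ.out

namespace Represents

variable {n : ℕ} {G : SimpleGraph (Fin n)} {κ : Config n} {s : State}

theorem setVar_one (h : Represents G κ s) (k : ℕ) : Represents G κ (s.setVar 1 k) :=
  ⟨h.var_zero, h.adj_iff, h.mem_reg_iff, h.var_add_three, h.outputs⟩

theorem setVar_two (h : Represents G κ s) (k : ℕ) : Represents G κ (s.setVar 2 k) :=
  ⟨h.var_zero, h.adj_iff, h.mem_reg_iff, h.var_add_three, h.outputs⟩

theorem setVar_add_three (h : Represents G κ s) (x k : ℕ) :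
    Represents G (κ.setPar x k) (s.setVar (x + 3) k) where
  var_zero := h.var_zero
  adj_iff := h.adj_iff
  mem_reg_iff := h.mem_reg_iff
  var_add_three y := by
    rcases eq_or_ne y x with rfl | hyx
    · simp [State.setVar, Config.setPar]
    · simpa [State.setVar, Config.setPar, hyx] using h.var_add_three y
  outputs := h.outputs

theorem exists_exec_storeReg (h : Represents G κ s) {v : Fin n} (hv : s.var 1 = v) (r : Reg)
    (e : Expr) :
    ∃ s', Exec (.store r.array (.var 1) (.const 0) e) s (e.cost + 3) s' ∧ s'.var = s.var ∧
      ∃ X, Represents G (κ.setReg r X) s' ∧ (v ∈ X ↔ e.eval s ≠ 0) ∧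
        ∀ w ≠ v, w ∈ X ↔ w ∈ κ.reg r := by
  have hex := Exec.store r.array (.var 1) (.const 0) e s
  rw [show (Expr.var 1).cost + (Expr.const 0).cost + e.cost + 1 = e.cost + 3 by
    simp only [Expr.cost]; lia] at hex
  refine ⟨_, hex, rfl,
    {w | w = v ∧ e.eval s ≠ 0 ∨ w ≠ v ∧ w ∈ κ.reg r},
    ⟨h.var_zero, h.adj_iff, fun r' w => ?_, h.var_add_three, h.outputs⟩, by simp,
    fun w hw => by simp [hw]⟩
  rcases eq_or_ne r' r with rfl | hr
  · rcases eq_or_ne w v with rfl | hw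
    · simp [Expr.eval, hv, Config.setReg]
    · simpa [Expr.eval, hv, Config.setReg, Fin.val_inj, hw] using h.mem_reg_iff r' w
  · simpa [Expr.eval, Config.setReg, hr, Reg.array_injective.ne hr] using h.mem_reg_iff r' w

theorem exists_exec_addToReg (h : Represents G κ s) {v : Fin n} (hv : s.var 1 = v) (r : Reg)
    (e : Expr) :
    ∃ s', Exec (.store r.array (.var 1) (.const 0) (.add (.read r.array (.var 1) (.const 0)) e)) s
        (e.cost + 7) s' ∧ s'.var = s.var ∧
      ∃ X, Represents G (κ.setReg r X) s' ∧ (v ∈ X ↔ v ∈ κ.reg r ∨ e.eval s ≠ 0) ∧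
        ∀ w ≠ v, w ∈ X ↔ w ∈ κ.reg r := by
  obtain ⟨s', hex, hvar, X, hs', hvX, hX⟩ := h.exists_exec_storeReg hv r
    (.add (.read r.array (.var 1) (.const 0)) e)
  rw [show (Expr.add (.read r.array (.var 1) (.const 0)) e).cost + 3 = e.cost + 7 by
    simp only [Expr.cost]; lia] at hex
  refine ⟨s', hex, hvar, X, hs', ?_, hX⟩
  rw [hvX, ← h.mem_reg_iff]
  simp only [Expr.eval, hv]
  lia

end Represents

section Tests

/-- The condition `Q` on two vertices `v` and `u`, which may refer to the abstract memory state, is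
tested by a fixed expression in which `v` and `u` are the values of the variables `1` and `2`. -/
def IsTest (Q : ∀ n, SimpleGraph (Fin n) → Config n → Fin n → Fin n → Prop) : Prop :=
  ∃ e : Expr, ∀ n G κ (v u : Fin n) s, Represents G κ s → s.var 1 = v → s.var 2 = u →
    (e.eval s ≠ 0 ↔ Q n G κ v u)

variable {Q Q' : ∀ n, SimpleGraph (Fin n) → Config n → Fin n → Fin n → Prop}

theorem isTest_adj : IsTest fun _ G _ v u => G.Adj v u :=
  ⟨.read 0 (.var 1) (.var 2), fun _ _ _ v u s h hv hu => by
    simpa [Expr.eval, hv, hu] using h.adj_iff v u⟩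

theorem isTest_mem_reg (r : Reg) : IsTest fun _ _ κ v _ => v ∈ κ.reg r :=
  ⟨.read r.array (.var 1) (.const 0), fun _ _ _ v _ s h hv _ => by
    simpa [Expr.eval, hv] using h.mem_reg_iff r v⟩

theorem isTest_mem_reg' (r : Reg) : IsTest fun _ _ κ _ u => u ∈ κ.reg r :=
  ⟨.read r.array (.var 2) (.const 0), fun _ _ _ _ u s h _ hu => by
    simpa [Expr.eval, hu] using h.mem_reg_iff r u⟩

theorem isTest_par_ne_zero (x : ℕ) : IsTest fun _ _ κ _ _ => κ.par x ≠ 0 :=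
  ⟨.var (x + 3), fun _ _ _ _ _ s h _ _ => by simp [Expr.eval, h.var_add_three]⟩

theorem isTest_par_eq (x : ℕ) : IsTest fun _ _ κ v _ => κ.par x = v :=
  ⟨.eq (.var (x + 3)) (.var 1), fun _ _ _ _ _ s h hv _ => by
    simp [Expr.eval, h.var_add_three, hv]⟩

theorem isTest_par_eq' (x : ℕ) : IsTest fun _ _ κ _ u => κ.par x = u :=
  ⟨.eq (.var (x + 3)) (.var 2), fun _ _ _ _ _ s h _ hu => by
    simp [Expr.eval, h.var_add_three, hu]⟩

namespace IsTest

theorem not (h : IsTest Q) : IsTest fun n G κ v u => ¬ Q n G κ v u := by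
  obtain ⟨e, he⟩ := h
  refine ⟨.eq e (.const 0), fun n G κ v u s hs hv hu => ?_⟩
  simp only [← he n G κ v u s hs hv hu, not_not, Expr.eval]
  by_cases h : e.eval s = 0 <;> simp [h]

theorem or (h : IsTest Q) (h' : IsTest Q') :
    IsTest fun n G κ v u => Q n G κ v u ∨ Q' n G κ v u := by
  obtain ⟨e, he⟩ := h
  obtain ⟨e', he'⟩ := h'
  refine ⟨.add e e', fun n G κ v u s hs hv hu => ?_⟩
  simp only [Expr.eval, ← he n G κ v u s hs hv hu, ← he' n G κ v u s hs hv hu]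
  lia

theorem and (h : IsTest Q) (h' : IsTest Q') :
    IsTest fun n G κ v u => Q n G κ v u ∧ Q' n G κ v u := by
  simpa only [not_or, not_not] using (h.not.or h'.not).not

theorem exists_lt (m : ℕ) {Q : ℕ → ∀ n, SimpleGraph (Fin n) → Config n → Fin n → Fin n → Prop}
    (h : ∀ i, IsTest (Q i)) : IsTest fun n G κ v u => ∃ i < m, Q i n G κ v u := by
  induction m with
  | zero => exact ⟨.const 0, fun n G κ v u s _ _ _ => by simp [Expr.eval]⟩
  | succ m ih => simpa only [Nat.exists_lt_succ_right] using ih.or (h m)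

end IsTest

end Tests

namespace Config

variable {n : ℕ} (κ : Config n)

@[simp]
theorem par_setPar_self (x k : ℕ) : (κ.setPar x k).par x = k := by
  simp [setPar]

@[simp]
theorem setReg_setReg (r : Reg) (X Y : Set (Fin n)) :
    (κ.setReg r X).setReg r Y = κ.setReg r Y := by
  simp [setReg]

/-- Apply `F` repeatedly, with the parameter `x` running through `0, …, n + k - 1`. -/
def forTo (x k : ℕ) (F : Config n → Config n) (κ : Config n) : Config n :=
  (fun κ' => (F κ').setPar x (κ'.par x + 1))^[n + k] (κ.setPar x 0)

theorem par_iterate_setPar (x : ℕ) (F : Config n → Config n) (i : ℕ) :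
    ((fun κ' => (F κ').setPar x (κ'.par x + 1))^[i] (κ.setPar x 0)).par x = i := by
  induction i with
  | zero => simp
  | succ i ih => rw [Function.iterate_succ_apply', par_setPar_self, ih]

end Config

/-- The operation `F` on the abstract memory states is implemented by a program that runs in
polynomial time. -/
def IsPolyTime (F : ∀ n, SimpleGraph (Fin n) → Config n → Config n) : Prop :=
  ∃ (c : Prog) (p : Polynomial ℕ), ∀ n G κ,
    Triple (Represents G κ) c (p.eval n) (Represents G (F n G κ))

namespace IsPolyTime

open Polynomial in
theorem comp {F F' : ∀ n, SimpleGraph (Fin n) → Config n → Config n} (h' : IsPolyTime F')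
    (h : IsPolyTime F) : IsPolyTime fun n G κ => F' n G (F n G κ) := by
  obtain ⟨c, p, hc⟩ := h
  obtain ⟨c', p', hc'⟩ := h'
  exact ⟨.seq c c', p + p', fun n G κ => by
    simpa only [eval_add] using (hc n G κ).seq (hc' n G _)⟩

open Polynomial in
theorem forTo (x k : ℕ) {F : ∀ n, SimpleGraph (Fin n) → Config n → Config n} (h : IsPolyTime F)
    (hF : ∀ n G κ, (F n G κ).par x = κ.par x) : IsPolyTime fun n G => Config.forTo x k (F n G) := by
  obtain ⟨c, p, hc⟩ := h
  refine ⟨forProg (x + 3) k c, (X + C k) * (p + 10) + 8, fun n G κ => ?_⟩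
  have hloop := triple_forProg (x := x + 3) (k := k) (N := n + k) (c := c) (t := p.eval n)
    (fun i => Represents G
      ((fun κ' => (F n G κ').setPar x (κ'.par x + 1))^[i] (κ.setPar x 0)))
    (fun i s hs => ⟨(hs.var_add_three x).trans (κ.par_iterate_setPar x _ i), by rw [hs.var_zero]⟩)
    fun i _ s hs => by
      obtain ⟨t, ht, s', hex, hs'⟩ := hc n G _ s hs
      refine ⟨t, ht, s', hex, ?_, ?_⟩
      · rw [hs'.var_add_three, hF, Config.par_iterate_setPar]
      · simpa only [Function.iterate_succ_apply', Config.par_iterate_setPar]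
          using hs'.setVar_add_three x (i + 1)
  simpa [Triple, Config.forTo] using fun s hs => hloop s (hs.setVar_add_three x 0)

end IsPolyTime

section Comprehension

variable {n : ℕ} {G : SimpleGraph (Fin n)} {κ : Config n} {r : Reg} {e : Expr}
  {Q : Fin n → Fin n → Prop}

/-- The program that puts the value of the variable `1` into the set `r` or removes it from `r`,
according to whether `e ≠ 0` for some vertex as the value of the variable `2`. -/
def comprRowProg (r : Reg) (e : Expr) : Prog :=
  .seq (.store r.array (.var 1) (.const 0) (.const 0)) (forProg 2 0
    (.store r.array (.var 1) (.const 0) (.add (.read r.array (.var 1) (.const 0)) e)))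

theorem triple_comprRowProg
    (he : ∀ X (v u : Fin n) s, Represents G (κ.setReg r X) s → s.var 1 = v → s.var 2 = u →
      (e.eval s ≠ 0 ↔ Q v u)) (v : Fin n) :
    Triple (fun s => s.var 1 = v ∧ ∃ X, Represents G (κ.setReg r X) s ∧
        ∀ w < v, w ∈ X ↔ ∃ u, Q w u)
      (comprRowProg r e) (4 + (n * (e.cost + 17) + 8))
      (fun s => s.var 1 = v ∧ ∃ X, Represents G (κ.setReg r X) s ∧
        ∀ w ≤ v, w ∈ X ↔ ∃ u, Q w u) := by
  let I (j : ℕ) (s : State) : Prop := s.var 1 = v ∧ s.var 2 = j ∧ ∃ X,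
    Represents G (κ.setReg r X) s ∧ (∀ w < v, w ∈ X ↔ ∃ u, Q w u) ∧
      (v ∈ X ↔ ∃ u : Fin n, u < j ∧ Q v u)
  have hclear : Triple (fun s => s.var 1 = v ∧ ∃ X, Represents G (κ.setReg r X) s ∧
      ∀ w < v, w ∈ X ↔ ∃ u, Q w u) (.store r.array (.var 1) (.const 0) (.const 0)) 4
      fun s => I 0 (s.setVar 2 0) := by
    rintro s ⟨hv, X, hs, hX⟩
    obtain ⟨s', hex, hvar, Y, hs', hvY, hY⟩ := hs.exists_exec_storeReg hv r (.const 0)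
    refine ⟨_, le_rfl, s', hex, (congrFun hvar 1).trans hv, rfl, Y, ?_, fun w hw => ?_, ?_⟩
    · simpa using hs'.setVar_two 0
    · simpa [hY w hw.ne, Config.setReg] using hX w hw
    · simpa [Expr.eval] using hvY
  have hstep : ∀ i < n, Triple (I i) (.store r.array (.var 1) (.const 0)
      (.add (.read r.array (.var 1) (.const 0)) e)) (e.cost + 7)
      fun s => s.var 2 = i ∧ I (i + 1) (s.setVar 2 (i + 1)) := by
    rintro i hi s ⟨hv, hu, X, hs, hX, hvX⟩
    obtain ⟨s', hex, hvar, Y, hs', hvY, hY⟩ := hs.exists_exec_addToReg hv r e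
    refine ⟨_, le_rfl, s', hex, (congrFun hvar 2).trans hu, (congrFun hvar 1).trans hv, rfl, Y, ?_,
      fun w hw => ?_, ?_⟩
    · simpa using hs'.setVar_two (i + 1)
    · simpa [hY w hw.ne, Config.setReg] using hX w hw
    · rw [hvY, he X v ⟨i, hi⟩ s hs hv hu]
      simp only [Config.setReg, Function.update_self, hvX, Order.lt_add_one_iff, le_iff_lt_or_eq,
        or_and_right, exists_or]
      refine or_congr_right ⟨fun h => ⟨_, rfl, h⟩, fun ⟨u, hu, h⟩ => ?_⟩
      rwa [show (⟨i, hi⟩ : Fin n) = u from Fin.ext hu.symm]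
  have hloop := triple_forProg (k := 0) I (fun i s ⟨_, hi, X, hs, _⟩ => ⟨hi, hs.var_zero⟩) hstep
  intro s hs
  obtain ⟨t, ht, s', hex, hv, -, X, hs', hX, hvX⟩ := (hclear.seq hloop) s hs
  refine ⟨t, ht, s', hex, hv, X, hs', fun w hw => ?_⟩
  rcases hw.eq_or_lt with rfl | hw
  · simpa using hvX
  · exact hX w hw

open Polynomial in
theorem IsPolyTime.compr {r : Reg}
    {Q : ∀ n, SimpleGraph (Fin n) → Config n → Fin n → Fin n → Prop} (h : IsTest Q)
    (hQ : ∀ n G κ Y v u, Q n G (κ.setReg r Y) v u ↔ Q n G κ v u)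
    {F : ∀ n, SimpleGraph (Fin n) → Config n → Set (Fin n)}
    (hF : ∀ n G κ v, v ∈ F n G κ ↔ ∃ u, Q n G κ v u) :
    IsPolyTime fun n G κ => κ.setReg r (F n G κ) := by
  obtain ⟨e, he⟩ := h
  refine ⟨forProg 1 0 (comprRowProg r e), X * (4 + (X * (C e.cost + 17) + 8) + 10) + 8,
    fun n G κ => ?_⟩
  let I (i : ℕ) (s : State) : Prop := s.var 1 = i ∧ ∃ X, Represents G (κ.setReg r X) s ∧
    ∀ w : Fin n, w < i → (w ∈ X ↔ ∃ u, Q n G κ w u)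
  have hstep : ∀ i < n, Triple (I i) (comprRowProg r e) (4 + (n * (e.cost + 17) + 8))
      fun s => s.var 1 = i ∧ I (i + 1) (s.setVar 1 (i + 1)) := by
    intro i hi s hs
    obtain ⟨t, ht, s', hex, hv, Y, hs', hY⟩ := triple_comprRowProg (Q := Q n G κ)
      (fun X v u s hs hv hu => (he _ _ _ v u s hs hv hu).trans (hQ n G κ X v u)) ⟨i, hi⟩ s hs
    exact ⟨t, ht, s', hex, hv, rfl, Y, hs'.setVar_one _, fun w hw => hY w (Nat.le_of_lt_succ hw)⟩
  have hloop := triple_forProg (k := 0) I (fun i s ⟨hi, X, hs, _⟩ => ⟨hi, hs.var_zero⟩) hstep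
  intro s hs
  obtain ⟨t, ht, s', hex, -, Y, hs', hY⟩ := hloop s
    ⟨rfl, κ.reg r, by simpa [Config.setReg] using hs.setVar_one 0, by simp⟩
  refine ⟨t, by simpa using ht, s', hex, ?_⟩
  have hYF : Y = F n G κ := Set.ext fun w => (hY w w.isLt).trans (hF n G κ w).symm
  simpa only [hYF] using hs'

end Comprehension

section Emit

theorem OutputsFamily.cons {n : ℕ} {o : List (List ℕ)} {𝓢 : Set (Set (Fin n))} {l : List ℕ}
    {X : Set (Fin n)} (ho : OutputsFamily o 𝓢) (hl : ∀ x, x ∈ l ↔ ∃ v ∈ X, (v : ℕ) = x) :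
    OutputsFamily (l :: o) (insert X 𝓢) := by
  refine ⟨List.forall_mem_cons.2 ⟨fun x hx => ?_, ho.1⟩, ?_⟩
  · obtain ⟨v, -, rfl⟩ := (hl x).1 hx
    exact v.isLt
  · have hX : X = {v : Fin n | (v : ℕ) ∈ l} := by
      ext v
      simp [hl, Fin.val_inj]
    ext Y
    simp [ho.2, ← hX]

/-- The program that outputs the set `r`. -/
def emitProg (r : Reg) : Prog :=
  .seq .newList (forProg 1 0 (.ite (.read r.array (.var 1) (.const 0)) (.put (.var 1)) .skip))

open Polynomial in
theorem IsPolyTime.emit (r : Reg) : IsPolyTime fun _ _ κ => κ.emit r := by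
  refine ⟨emitProg r, 1 + (X * 17 + 8), fun n G κ => ?_⟩
  let mem (x : ℕ) : Prop := ∃ v ∈ κ.reg r, (v : ℕ) = x
  let I (i : ℕ) (s : State) : Prop := s.var 1 = i ∧ ∃ l o, s.out = l :: o ∧
    Represents G κ { s with out := o } ∧ ∀ x, x ∈ l ↔ x < i ∧ mem x
  have hstep : ∀ i < n, Triple (I i)
      (.ite (.read r.array (.var 1) (.const 0)) (.put (.var 1)) .skip) 7
      fun s => s.var 1 = i ∧ I (i + 1) (s.setVar 1 (i + 1)) := by
    intro i hi
    have hread : ∀ s, I i s → ((Expr.read r.array (.var 1) (.const 0)).eval s ≠ 0 ↔ mem i) := by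
      rintro s ⟨hv, l, o, -, hs, -⟩
      have hmem : mem i ↔ ⟨i, hi⟩ ∈ κ.reg r := by simp [mem, Fin.exists_iff, hi]
      rw [hmem, ← hs.mem_reg_iff]
      simp [Expr.eval, hv]
    refine triple_iteSkip (t := 2) ?_ fun s hs he => ?_
    · rintro s ⟨hs, he⟩
      have hi := (hread s hs).1 he
      obtain ⟨hv, l, o, hout, hs, hl⟩ := hs
      refine ⟨_, le_rfl, _, .put _ _, hv, rfl, i :: l, o, ?_, hs.setVar_one (i + 1), fun x => ?_⟩
      · simp [State.setVar, hout, putOut, Expr.eval, hv]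
      · grind
    · have hi : ¬ mem i := fun h => (hread s hs).2 h he
      obtain ⟨hv, l, o, hout, hs, hl⟩ := hs
      exact ⟨hv, rfl, l, o, hout, hs.setVar_one (i + 1), by grind⟩
  have hloop := triple_forProg (k := 0) I (fun i s ⟨hi, _, _, _, hs, _⟩ => ⟨hi, hs.var_zero⟩) hstep
  intro s hs
  obtain ⟨t, ht, s', hex, -, l, o, hout, hs', hl⟩ := hloop { s with out := [] :: s.out }
    ⟨rfl, [], s.out, rfl, hs.setVar_one 0, by simp⟩
  refine ⟨1 + t, by simpa using ht, s', (Exec.newList s).seq hex,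
    hs'.var_zero, hs'.adj_iff, hs'.mem_reg_iff, hs'.var_add_three, ?_⟩
  rw [hout]
  exact hs'.outputs.cons fun x => (hl x).trans
    ⟨fun h => h.2, fun ⟨v, hv, hx⟩ => ⟨hx ▸ v.isLt, v, hv, hx⟩⟩

end Emit

/-- The `k`-th of the sets encoded by numerical parameters: each of them is encoded by `m` of the
numbers `π 3, π 4, …`, where numbers that are not vertices are ignored. -/
def paramSet (n m : ℕ) (π : ℕ → ℕ) (k : ℕ) : Set (Fin n) := {v | ∃ i < m, π (3 + k * m + i) = v}

/-- The guess encoded by numerical parameters, where `π 1` and `π 2` encode the flags. The parameter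
`0` is left for counting the rounds of the closure procedure. -/
def Guess.ofParams (n m : ℕ) (π : ℕ → ℕ) : Guess (Fin n) where
  seed := paramSet n m π 0
  seen := paramSet n m π 1
  avoided := paramSet n m π 2
  dominating := paramSet n m π 3
  added := paramSet n m π 4
  kept := paramSet n m π 5
  skipAdj := π 1 ≠ 0
  skipNonAdj := π 2 ≠ 0

theorem Guess.ofParams_congr {n m : ℕ} {π π' : ℕ → ℕ}
    (h : ∀ i, i ≠ 0 → i < 6 * m + 3 → π i = π' i) : ofParams n m π = ofParams n m π' := by
  have hset : ∀ k < 6, paramSet n m π k = paramSet n m π' k := by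
    intro k hk
    have hπ : ∀ i < m, π (3 + k * m + i) = π' (3 + k * m + i) := fun i hi =>
      h _ (by lia) (by interval_cases k <;> lia)
    ext v
    exact exists_congr fun i => and_congr_right fun hi => by rw [hπ i hi]
  simp [ofParams, hset, h 1, h 2]

theorem exists_enum_of_ncard_le {n m : ℕ} {X : Set (Fin n)} (hX : X.ncard ≤ m) :
    ∃ f : ℕ → ℕ, (∀ i, f i ≤ n) ∧ X = {v : Fin n | ∃ i < m, f i = v} := by
  classical
  let l := X.toFinset.toList
  have hl : l.length ≤ m := by rwa [Finset.length_toList, ← Set.ncard_eq_toFinset_card']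
  refine ⟨fun i => l[i]?.elim n Fin.val, fun i => ?_, Set.ext fun v => ?_⟩
  · change l[i]?.elim n Fin.val ≤ n
    cases l[i]? with
    | none => exact le_rfl
    | some v => exact v.isLt.le
  · have hget : ∀ i : ℕ, l[i]?.elim n Fin.val = v ↔ l[i]? = some v := fun i => by
      cases l[i]? with
      | none => simpa using v.isLt.ne'
      | some w => simp [Fin.val_inj]
    have hmem : v ∈ X ↔ ∃ i : ℕ, l[i]? = some v := by
      rw [← List.mem_iff_getElem?, Finset.mem_toList, Set.mem_toFinset]
    rw [hmem]
    refine exists_congr fun i => (hget i).symm.trans (and_iff_right_of_imp fun h => ?_).symm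
    exact (List.getElem?_eq_some_iff.1 ((hget i).1 h)).1.trans_le hl

theorem exists_paramSet_eq {n m : ℕ} {X : ℕ → Set (Fin n)} (hX : ∀ k, (X k).ncard ≤ m)
    (b b' : Prop) :
    ∃ π : ℕ → ℕ, (∀ i, π i < n + 2) ∧ (π 1 ≠ 0 ↔ b) ∧ (π 2 ≠ 0 ↔ b') ∧
      ∀ k, paramSet n m π k = X k := by
  classical
  choose f hf hfX using fun k => exists_enum_of_ncard_le (hX k)
  let π (j : ℕ) : ℕ :=
    if j = 1 then if b then 1 else 0
    else if j = 2 then if b' then 1 else 0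
    else f ((j - 3) / m) ((j - 3) % m)
  refine ⟨π, fun i => ?_, by simp [π], by simp [π], fun k => ?_⟩
  · have := hf ((i - 3) / m) ((i - 3) % m)
    simp only [π]
    split_ifs <;> lia
  · rw [hfX]
    refine Set.ext fun v => exists_congr fun i => and_congr_right fun hi => ?_
    have hdiv : (k * m + i) / m = k := by
      rw [mul_comm, Nat.mul_add_div (by lia), Nat.div_eq_of_lt hi, add_zero]
    have hmod : (k * m + i) % m = i := by rw [Nat.mul_add_mod', Nat.mod_eq_of_lt hi]
    have hπ : π (3 + k * m + i) = f k i := by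
      simp only [π, add_assoc, Nat.add_sub_cancel_left, hdiv, hmod]
      rw [if_neg (by lia), if_neg (by lia)]
    rw [hπ]

theorem Guess.exists_ofParams_eq {n m : ℕ} {g : Guess (Fin n)} (hg : g.IsSmall m) :
    ∃ π, (∀ i, π i < n + 2) ∧ ofParams n m π = g := by
  obtain ⟨hseed, hseen, havoided, hdominating, hadded, hkept⟩ := hg
  let X : ℕ → Set (Fin n)
    | 0 => g.seed
    | 1 => g.seen
    | 2 => g.avoided
    | 3 => g.dominating
    | 4 => g.added
    | _ => g.kept
  have hX : ∀ k, (X k).ncard ≤ m := by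
    rintro (_ | _ | _ | _ | _ | _) <;> assumption
  obtain ⟨π, hπ, hskip, hskip', hset⟩ := exists_paramSet_eq hX g.skipAdj g.skipNonAdj
  refine ⟨π, hπ, ?_⟩
  simp only [ofParams, hset, hskip, hskip', X]

theorem isTest_mem_paramSet (m k : ℕ) : IsTest fun n _ κ v _ => v ∈ paramSet n m κ.par k :=
  .exists_lt m fun i => isTest_par_eq (3 + k * m + i)

theorem isTest_mem_paramSet' (m k : ℕ) : IsTest fun n _ κ _ u => u ∈ paramSet n m κ.par k :=
  .exists_lt m fun i => isTest_par_eq' (3 + k * m + i)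

namespace Config

variable {n : ℕ}

/-- Compute everything that the closure procedure needs. -/
def prepare (m : ℕ) (G : SimpleGraph (Fin n)) (κ : Config n) : Config n :=
  let g := Guess.ofParams n m κ.par
  (((κ.setReg .near (farFrom G g.dominating)ᶜ).setReg .frame (g.frame G)).setReg
    .blocked (g.region G)ᶜ).setReg .current g.seed

/-- One round of the closure procedure. -/
def round (G : SimpleGraph (Fin n)) (κ : Config n) : Config n :=
  let A := {v | κ.par 1 ≠ 0 ∨ ∃ u ∈ κ.reg .current, G.Adj v u}
  let B := {v | κ.par 2 ≠ 0 ∨ ∃ u ∈ κ.reg .current, ¬ G.Adj v u}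
  let X := {v | v ∈ κ.reg .current ∨ v ∉ κ.reg .blocked ∧ v ∈ A ∧ v ∈ B}
  (((κ.setReg .adjacent A).setReg .nonadjacent B).setReg .next X).setReg .current X

/-- Output the candidate determined by the result of the closure procedure. -/
def finish (m : ℕ) (G : SimpleGraph (Fin n)) (κ : Config n) : Config n :=
  (κ.setReg .separator (nbhd G (κ.reg .current ∪ (Guess.ofParams n m κ.par).added) ∪
    κ.reg .frame)).emit .separator

/-- Output the candidate determined by the guess encoded by the parameters. -/
def emitCandidate (m : ℕ) (G : SimpleGraph (Fin n)) (κ : Config n) : Config n :=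
  ((κ.prepare m G).forTo 0 0 (round G)).finish m G

end Config

theorem exists_or_right_iff {n : ℕ} {p : Prop} {q : Fin n → Prop} (v : Fin n) :
    (∃ u, q u ∨ p) ↔ (∃ u, q u) ∨ p := by
  have : Nonempty (Fin n) := ⟨v⟩
  simp only [exists_or, exists_const]

theorem isPolyTime_prepare (m : ℕ) : IsPolyTime fun _ G κ => κ.prepare m G := by
  let g (n : ℕ) (κ : Config n) : Guess (Fin n) := .ofParams n m κ.par
  have hnear : IsPolyTime fun n G κ => κ.setReg .near (farFrom G (g n κ).dominating)ᶜ :=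
    .compr (((isTest_mem_paramSet' m 3).and isTest_adj).or
        (isTest_mem_paramSet m 3))
      (fun _ _ _ _ _ _ => Iff.rfl) fun _ _ _ v => by
        simp only [farFrom, Guess.ofParams, Set.mem_compl_iff, Set.mem_ofPred_eq,
          exists_or_right_iff v, g]
        grind
  have hframe : IsPolyTime fun n G κ =>
      κ.setReg .frame (nbhd G (κ.reg .near)ᶜ ∪ (g n κ).kept) :=
    .compr (((isTest_mem_reg .near).and ((isTest_mem_reg' .near).not.and isTest_adj)).or
        (isTest_mem_paramSet m 5))
      (fun _ _ _ _ _ _ => by simp [Config.setReg]) fun _ _ _ v => by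
        simp [exists_or_right_iff v, nbhd, g, Guess.ofParams]
  have hblocked : IsPolyTime fun n G κ => κ.setReg .blocked
      {v | (∀ u ∈ (g n κ).seen, G.Adj v u) ∧ v ∈ farFrom G (g n κ).avoided ∧ v ∉ κ.reg .frame}ᶜ :=
    .compr ((((isTest_mem_paramSet' m 1).and isTest_adj.not).or
      ((isTest_mem_paramSet' m 2).and isTest_adj)).or
      ((isTest_mem_paramSet m 2).or (isTest_mem_reg .frame)))
      (fun _ _ _ _ _ _ => by simp [Config.setReg]) fun _ _ _ v => by
        simp only [Guess.ofParams, farFrom, Set.mem_compl_iff, Set.mem_ofPred_eq, exists_or,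
          exists_or_right_iff v, g]
        grind
  have hcurrent : IsPolyTime fun n _ κ => κ.setReg .current (g n κ).seed :=
    .compr (isTest_mem_paramSet m 0) (fun _ _ _ _ _ _ => Iff.rfl) fun _ _ _ v =>
      ⟨fun h => ⟨v, h⟩, fun ⟨_, h⟩ => h⟩
  convert ((hcurrent.comp hblocked).comp hframe).comp hnear using 4 with n _ κ
  simp [Config.prepare, Config.setReg, Guess.region, Guess.frame, g]

theorem isPolyTime_round : IsPolyTime fun _ G κ => κ.round G := by
  have hadj : IsPolyTime fun n G κ => κ.setReg .adjacent
      {v | κ.par 1 ≠ 0 ∨ ∃ u ∈ κ.reg .current, G.Adj v u} :=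
    .compr (((isTest_mem_reg' .current).and isTest_adj).or (isTest_par_ne_zero 1))
      (fun _ _ _ _ _ _ => by simp [Config.setReg])
      fun _ _ _ v => or_comm.trans (exists_or_right_iff v).symm
  have hnonadj : IsPolyTime fun n G κ => κ.setReg .nonadjacent
      {v | κ.par 2 ≠ 0 ∨ ∃ u ∈ κ.reg .current, ¬ G.Adj v u} :=
    .compr (((isTest_mem_reg' .current).and isTest_adj.not).or (isTest_par_ne_zero 2))
      (fun _ _ _ _ _ _ => by simp [Config.setReg])
      fun _ _ _ v => or_comm.trans (exists_or_right_iff v).symm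
  have hnext : IsPolyTime fun _ _ κ => κ.setReg .next {v | v ∈ κ.reg .current ∨
      v ∉ κ.reg .blocked ∧ v ∈ κ.reg .adjacent ∧ v ∈ κ.reg .nonadjacent} :=
    .compr ((isTest_mem_reg .current).or ((isTest_mem_reg .blocked).not.and
        ((isTest_mem_reg .adjacent).and (isTest_mem_reg .nonadjacent))))
      (fun _ _ _ _ _ _ => by simp [Config.setReg]) fun _ _ _ v =>
        ⟨fun h => ⟨v, h⟩, fun ⟨_, h⟩ => h⟩
  have hcurrent : IsPolyTime fun _ _ κ => κ.setReg .current (κ.reg .next) :=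
    .compr (isTest_mem_reg .next) (fun _ _ _ _ _ _ => by simp [Config.setReg])
      fun _ _ _ v => ⟨fun h => ⟨v, h⟩, fun ⟨_, h⟩ => h⟩
  exact ((hcurrent.comp hnext).comp hnonadj).comp hadj

theorem isPolyTime_finish (m : ℕ) : IsPolyTime fun _ G κ => κ.finish m G :=
  (IsPolyTime.emit .separator).comp (.compr (((((isTest_mem_reg .current).or
      (isTest_mem_paramSet m 4)).not.and (((isTest_mem_reg' .current).or
      (isTest_mem_paramSet' m 4)).and isTest_adj))).or (isTest_mem_reg .frame))
    (fun _ _ _ _ _ _ => by simp [Config.setReg]) fun _ _ _ v => by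
      simp [exists_or_right_iff v, nbhd, Guess.ofParams])

theorem isPolyTime_emitCandidate (m : ℕ) : IsPolyTime fun _ G κ => κ.emitCandidate m G :=
  (isPolyTime_finish m).comp ((isPolyTime_round.forTo 0 0 fun _ _ _ => rfl).comp
    (isPolyTime_prepare m))

namespace Config

variable {n : ℕ} (m : ℕ) (G : SimpleGraph (Fin n)) (κ : Config n)

theorem iterate_round (i : ℕ) :
    let g := Guess.ofParams n m κ.par
    let κ' := (fun κ' => (round G κ').setPar 0 (κ'.par 0 + 1))^[i] ((κ.prepare m G).setPar 0 0)
    κ'.par = Function.update κ.par 0 i ∧ κ'.reg .frame = g.frame G ∧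
      κ'.reg .blocked = (g.region G)ᶜ ∧ κ'.reg .current = (g.step G)^[i] g.seed ∧
        κ'.out = κ.out := by
  intro g
  induction i with
  | zero => simp [prepare, setPar, setReg, g]
  | succ i ih =>
    obtain ⟨hpar, hframe, hblocked, hcurrent, hout⟩ := ih
    simp only [Function.iterate_succ_apply'] at *
    set κ' := (fun κ' => (round G κ').setPar 0 (κ'.par 0 + 1))^[i] ((κ.prepare m G).setPar 0 0)
    refine ⟨?_, ?_, ?_, ?_, hout⟩
    · simp [round, setPar, setReg, hpar]
    · simp [round, setPar, setReg, hframe]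
    · simp [round, setPar, setReg, hblocked]
    · rw [← hcurrent]
      simp [round, setPar, setReg, hblocked, hpar, Guess.step, g, Guess.ofParams]

theorem par_emitCandidate {x : ℕ} (hx : x ≠ 0) : (κ.emitCandidate m G).par x = κ.par x := by
  have hpar := (κ.iterate_round m G (n + 0)).1
  exact (congrFun hpar x).trans (Function.update_of_ne hx _ _)

theorem out_emitCandidate :
    (κ.emitCandidate m G).out = insert ((Guess.ofParams n m κ.par).candidate G) κ.out := by
  obtain ⟨hpar, hframe, -, hcurrent, hout⟩ := κ.iterate_round m G (n + 0)
  have hg : Guess.ofParams n m (Function.update κ.par 0 (n + 0)) = Guess.ofParams n m κ.par :=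
    Guess.ofParams_congr fun i hi _ => Function.update_of_ne hi _ _
  simp only [emitCandidate, forTo, finish, emit, setReg, hpar, hg, hframe, hcurrent, hout]
  simp [Guess.candidate, Guess.closure]

end Config

namespace Config

variable {n : ℕ}

theorem par_iterate_setPar_of_ne {x y : ℕ} {F : Config n → Config n}
    (hF : ∀ κ, (F κ).par y = κ.par y) (hy : y ≠ x) (κ : Config n) (i : ℕ) :
    ((fun κ' => (F κ').setPar x (κ'.par x + 1))^[i] (κ.setPar x 0)).par y = κ.par y := by
  induction i with
  | zero => exact Function.update_of_ne hy _ _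
  | succ i ih =>
    rw [Function.iterate_succ_apply']
    exact (Function.update_of_ne hy _ _).trans ((hF _).trans ih)

theorem monotone_out_iterate_setPar (x : ℕ) {F : Config n → Config n}
    (hF : ∀ κ, κ.out ⊆ (F κ).out) (κ : Config n) :
    Monotone fun i => ((fun κ' => (F κ').setPar x (κ'.par x + 1))^[i] (κ.setPar x 0)).out := by
  refine monotone_nat_of_le_succ fun i => ?_
  simp only [Function.iterate_succ_apply']
  exact hF _

/-- Apply `F` repeatedly, with the parameters `1, …, j` running through all sequences of numbers
smaller than `n + 2`. -/
def forAllTo (F : Config n → Config n) : ℕ → Config n → Config n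
  | 0 => F
  | j + 1 => forTo (j + 1) 2 (forAllTo F j)

theorem par_forAllTo {F : Config n → Config n} (hF : ∀ κ, ∀ x ≠ 0, (F κ).par x = κ.par x)
    {j x : ℕ} (hx : j < x) (κ : Config n) : (forAllTo F j κ).par x = κ.par x := by
  induction j generalizing κ with
  | zero => exact hF κ x hx.ne'
  | succ j ih => exact par_iterate_setPar_of_ne (ih (by lia)) hx.ne' κ _

theorem out_subset_forAllTo {F : Config n → Config n} (hF : ∀ κ, κ.out ⊆ (F κ).out) (j : ℕ)
    (κ : Config n) : κ.out ⊆ (forAllTo F j κ).out := by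
  induction j generalizing κ with
  | zero => exact hF κ
  | succ j ih => exact monotone_out_iterate_setPar (j + 1) ih κ (Nat.zero_le _)

end Config

theorem isPolyTime_forAllTo {F : ∀ n, SimpleGraph (Fin n) → Config n → Config n}
    (hF : IsPolyTime F) (hpar : ∀ n G κ, ∀ x ≠ 0, (F n G κ).par x = κ.par x) (j : ℕ) :
    IsPolyTime fun n G => Config.forAllTo (F n G) j := by
  induction j with
  | zero => exact hF
  | succ j ih =>
    exact ih.forTo (j + 1) 2 fun n G κ => Config.par_forAllTo (hpar n G) (Nat.lt_succ_self j) κ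

theorem candidate_mem_out_forAllTo {n m j : ℕ} (G : SimpleGraph (Fin n)) {π : ℕ → ℕ}
    (hπ : ∀ i, π i < n + 2) (κ : Config n) (hκ : ∀ i, j < i → i < 6 * m + 3 → κ.par i = π i) :
    (Guess.ofParams n m π).candidate G ∈ (Config.forAllTo (Config.emitCandidate m G) j κ).out := by
  have hout : ∀ κ : Config n, κ.out ⊆ (κ.emitCandidate m G).out := fun κ =>
    (Set.subset_insert _ _).trans (κ.out_emitCandidate m G).ge
  induction j generalizing κ with
  | zero =>
    rw [Config.forAllTo, Config.out_emitCandidate,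
      Guess.ofParams_congr fun i hi => hκ i (Nat.pos_of_ne_zero hi)]
    exact Set.mem_insert _ _
  | succ j ih =>
    let F := Config.forAllTo (Config.emitCandidate m G) j
    let κ' := (fun κ' => (F κ').setPar (j + 1) (κ'.par (j + 1) + 1))^[π (j + 1)]
      (κ.setPar (j + 1) 0)
    have hκ' : ∀ i, j < i → i < 6 * m + 3 → κ'.par i = π i := by
      intro i hi him
      rcases (Nat.succ_le_of_lt hi).eq_or_lt with rfl | hji
      · exact κ.par_iterate_setPar (j + 1) F _
      · have hF : ∀ κ, (F κ).par i = κ.par i := Config.par_forAllTo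
          (fun κ _ hx => κ.par_emitCandidate m G hx) hi
        exact (Config.par_iterate_setPar_of_ne hF hji.ne' κ _).trans (hκ i hji him)
    refine Config.monotone_out_iterate_setPar (j + 1) (Config.out_subset_forAllTo hout j) κ
      (Nat.succ_le_of_lt (hπ (j + 1))) ?_
    simp only [Function.iterate_succ_apply']
    exact ih κ' hκ'

theorem exists_prog_returnsWithin_candidates (m : ℕ) :
    ∃ (c : Prog) (p : Polynomial ℕ), ∀ n (G : SimpleGraph (Fin n)), ∃ 𝓢 : Set (Set (Fin n)),
      ReturnsWithin c G (p.eval n) 𝓢 ∧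
        ∀ g : Guess (Fin n), g.IsSmall m → g.candidate G ∈ 𝓢 := by
  obtain ⟨c, p, hc⟩ := isPolyTime_forAllTo (isPolyTime_emitCandidate m)
    (fun _ G κ _ hx => κ.par_emitCandidate m G hx) (6 * m + 2)
  refine ⟨c, p, fun n G => ?_⟩
  let κ : Config n := ⟨0, fun _ => ∅, ∅⟩
  have hκ : Represents G κ (inputState G) := by
    refine ⟨by simp [inputState], fun u v => by simp [inputState], fun r v => ?_,
      fun x => by simp [inputState, κ], by simp [inputState, κ, OutputsFamily]⟩
    cases r <;> simp [inputState, κ, Reg.array]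
  obtain ⟨t, ht, s, hex, hs⟩ := hc n G κ _ hκ
  refine ⟨_, ⟨t, ht, s, hex, hs.outputs⟩, fun g hg => ?_⟩
  obtain ⟨π, hπ, rfl⟩ := Guess.exists_ofParams_eq hg
  exact candidate_mem_out_forAllTo G hπ κ fun i hi him => absurd him (by lia)

end SepCarving

theorem mainTheorem6_general (d : ℕ) :
    ∃ (c : SepCarving.Prog) (p : Polynomial ℕ),
      ∀ (n : ℕ) (G : SimpleGraph (Fin n)), SepCarving.P6Free G →
        ∃ 𝓢 : Set (Set (Fin n)), SepCarving.ReturnsWithin c G (p.eval n) 𝓢 ∧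
          ∀ T : SepCarving.RootedForest (Fin n), T.IsTDStructure G d →
            ∀ S : Set (Fin n), SepCarving.IsMinSep G S → (S ∩ T.verts).ncard ≤ d →
              ∃ S' ∈ 𝓢, T.IsCarver G S S' := by
  obtain ⟨c, p, hc⟩ := SepCarving.exists_prog_returnsWithin_candidates (d + 10)
  refine ⟨c, p, fun n G hG => ?_⟩
  obtain ⟨𝓢, hret, hcandidate⟩ := hc n G
  refine ⟨𝓢, hret, fun T hT S hS hST => ?_⟩
  obtain ⟨g, hg, hcarver⟩ := SepCarving.exists_guess_isCarver hG hT hS hST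
  exact ⟨_, hcandidate g hg, hcarver⟩

theorem mainTheorem6 (d : ℕ) (hd : 0 < d) :
    ∃ (c : SepCarving.Prog) (p : Polynomial ℕ),
      ∀ (n : ℕ) (G : SimpleGraph (Fin n)), SepCarving.P6Free G →
        ∃ 𝓢 : Set (Set (Fin n)), SepCarving.ReturnsWithin c G (p.eval n) 𝓢 ∧
          ∀ T : SepCarving.RootedForest (Fin n), T.IsMaximalTDStructure G d →
            ∀ S : Set (Fin n), T.IsAvoidingMinSep G d S →
              ∃ S' ∈ 𝓢, T.IsCarver G S S' := by
  obtain ⟨c, p, hc⟩ := mainTheorem6_general d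
  refine ⟨c, p, fun n G hG => (hc n G hG).imp fun 𝓢 h => ⟨h.1, fun T hT S hS => ?_⟩⟩
  exact h.2 T hT.1 S hS.1 (SepCarving.RootedForest.ncard_le_of_inVerticalPath hT.1.1 hS.2.1)
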